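/- A finite polysquare surface $\mathcal{P}$ is a connected surface obtained from finitely many closed unit squares by identifying, by translations, the right edges of the squares in pairs with left edges, and the top edges in pairs with bottom edges; it carries the flat distance. Let $\mathcal{L}(t)$, $t\ge 0$, be a half-infinite $1$-direction geodesic on $\mathcal{P}$ in arc-length parametrization, that is, a path which runs at unit speed along straight segments of one fixed direction and which for $t>0$ does not meet a singular vertex (a vertex where the total angle is not $2\pi$); its starting point is arbitrary. Call $\mathcal{L}$ superdense if there is a constant $C=C(\mathcal{P};\mathcal{L})>0$ such that for every integer $n\ge 1$ and every point $p$ of $\mathcal{P}$ there is some $t$ with $0\le t\le Cn$ such that $\mathcal{L}(t)$ is at distance at most $1/n$ from $p$. Then $\mathcal{L}$ is superdense if and only if its slope is a badly approximable number, that is, $\mathcal{L}$ is not vertical and its slope $\alpha\in\mathbb{R}$ satisfies $|\alpha-p/q|\ge c/q^2$ for some constant $c>0$ and all integers $p$ and $q\ge 1$. -/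

import Mathlib

/-- A finite polysquare surface: finitely many closed unit squares whose edges are identified in
pairs by translations. The right edge of the square `s` is identified with the left edge of
`right s`, and the top edge of `s` is identified with the bottom edge of `up s`. Since every right
(top) edge is identified with exactly one left (bottom) edge, `right` and `up` are permutations.
An edge shared by two squares of a planar net which is not a wall is recorded in the same way. The
surface is connected. -/
structure PolysquareSurface where
  /-- The set of atomic squares (square faces). -/
  Square : Type*
  finite_square : Finite Square
  nonempty_square : Nonempty Square
  /-- The square glued to the right edge. -/
  right : Equiv.Perm Square
  /-- The square glued to the top edge. -/
  up : Equiv.Perm Square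
  /-- Any two squares are joined by a chain of squares in which neighbours are glued along
  an edge. -/
  connected : ∀ s t : Square, Relation.EqvGen (fun a b => b = right a ∨ b = up a) s t

/-- The closed unit square `[0,1] × [0,1]` in the Euclidean plane. -/
def unitSquare : Set (EuclideanSpace ℝ (Fin 2)) :=
  {x | ∀ i, x i ∈ Set.Icc (0 : ℝ) 1}

namespace PolysquareSurface

/-- The edge identifications on the disjoint union of the closed atomic squares: right edges with
left edges, and top edges with bottom edges. -/
def Glue (P : PolysquareSurface) (p q : P.Square × unitSquare) : Prop :=
  (q.1 = P.right p.1 ∧ p.2.1 0 = 1 ∧ q.2.1 0 = 0 ∧ q.2.1 1 = p.2.1 1) ∨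
  (q.1 = P.up p.1 ∧ p.2.1 1 = 1 ∧ q.2.1 1 = 0 ∧ q.2.1 0 = p.2.1 0)

/-- The points of the surface: the disjoint union of the closed squares modulo the equivalence
relation generated by the edge identifications. -/
def Point (P : PolysquareSurface) : Type _ := Quot P.Glue

/-- The point of the surface with coordinates `x` in the closed square `s`. -/
def pt (P : PolysquareSurface) (s : P.Square) (x : unitSquare) : P.Point := Quot.mk P.Glue (s, x)

/-- `P.JoinedBy p q r` : the points `p` and `q` are joined by a broken line of total length `r` on the
surface, that is, by finitely many consecutive straight segments, each in one closed square. -/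
inductive JoinedBy (P : PolysquareSurface) : P.Point → P.Point → ℝ → Prop
  | refl (p : P.Point) : JoinedBy P p p 0
  | step {p : P.Point} {r : ℝ} (s : P.Square) (x y : unitSquare) :
      JoinedBy P p (P.pt s x) r → JoinedBy P p (P.pt s y) (r + dist x y)

/-- The flat (intrinsic) distance on the surface. -/
noncomputable def flatDist (P : PolysquareSurface) (p q : P.Point) : ℝ :=
  sInf {r : ℝ | P.JoinedBy p q r}

/-- The point `p` is a singular vertex (the total angle at `p` is not `2π`): `p` is the top right
corner of a square `s` such that the four steps right, up, left, down around this corner do not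
lead back to `s`. -/
def IsSingular (P : PolysquareSurface) (p : P.Point) : Prop :=
  ∃ (s : P.Square) (x : unitSquare), p = P.pt s x ∧ x.1 0 = 1 ∧ x.1 1 = 1 ∧
    P.up (P.right s) ≠ P.right (P.up s)

/-- `L`, restricted to `t ≥ 0`, is a half-infinite `1`-direction geodesic with unit direction
vector `u`, in arc-length parametrization. At every time it runs for a while inside a closed
square along a straight segment of direction `u`, and it came along such a segment, and it does not
run into a singular vertex. Its starting point is arbitrary. -/
structure IsGeodesic (P : PolysquareSurface) (L : ℝ → P.Point)
    (u : EuclideanSpace ℝ (Fin 2)) : Prop where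
  norm_eq_one : ‖u‖ = 1
  forward : ∀ t : ℝ, 0 ≤ t → ∃ ε : ℝ, 0 < ε ∧
    ∃ (s : P.Square) (x : EuclideanSpace ℝ (Fin 2)),
      ∀ τ ∈ Set.Icc (0 : ℝ) ε, ∃ h : x + τ • u ∈ unitSquare, L (t + τ) = P.pt s ⟨x + τ • u, h⟩
  backward : ∀ t : ℝ, 0 < t → ∃ ε : ℝ, 0 < ε ∧ ε ≤ t ∧
    ∃ (s : P.Square) (x : EuclideanSpace ℝ (Fin 2)),
      ∀ τ ∈ Set.Icc (0 : ℝ) ε, ∃ h : x - τ • u ∈ unitSquare, L (t - τ) = P.pt s ⟨x - τ • u, h⟩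
  not_isSingular : ∀ t : ℝ, 0 < t → ¬ P.IsSingular (L t)

/-- Superdensity: for some constant `C`, for every `n ≥ 1` the initial segment of length `C * n`
gets `1 / n`-close to every point of the surface. -/
def Superdense (P : PolysquareSurface) (L : ℝ → P.Point) : Prop :=
  ∃ C : ℝ, 0 < C ∧ ∀ n : ℕ, 1 ≤ n → ∀ p : P.Point,
    ∃ t ∈ Set.Icc (0 : ℝ) (C * n), P.flatDist (L t) p ≤ 1 / (n : ℝ)

end PolysquareSurface

/-- A real number is badly approximable if `|α - p / q| ≥ c / q ^ 2` for some constant `c > 0` and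
all fractions `p / q`. In particular it is irrational. -/
def BadlyApproximable (α : ℝ) : Prop :=
  ∃ c : ℝ, 0 < c ∧ ∀ (p : ℤ) (q : ℕ), 1 ≤ q → c / (q : ℝ) ^ 2 ≤ |α - (p : ℝ) / (q : ℝ)|

open Filter Topology
open scoped Pointwise

/-! Necessity: the function `q y - p x` modulo 1 descends to the surface, varies along the geodesic
at the constant rate `q u₁ - p u₀`, and is Lipschitz with constant `|p| + |q|`. A superdense
geodesic must come near points where this function differs by `1/2` from its initial value. With `n`
proportional to `|p| + |q|`, this bounds the rate below by a multiple of `1 / (|p| + |q|)`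
(`IsGeodesic.exists_le_mul_abs_sub`).

Sufficiency: recording the height and the square at each crossing of a vertical edge turns the
geodesic into an orbit of a skew product, with the squares as finite fibre, over the rotation by `β
= u₁ / |u₀|` (`IsGeodesic.exists_isSkewOrbit`). It suffices that this orbit reaches every interval
of length `δ` in every fibre within time `O(1/δ)`.

For the rotation alone this is Dirichlet's theorem combined with bad approximability. For the
fibres, consider the set of fibre values seen, in a time window, along each itinerary of length `ℓ`.
If its minimal size over the circle does not drop when `ℓ` is multiplied by `R + 2`, these sets form
an invariant family at an intermediate length; irrationality makes the family constant, and
connectedness of the surface makes it full (`visited_eq_univ_or_exists_ncard_lt`). The size can drop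
only boundedly often, so a window of length `O(ℓ)` suffices. -/

/-! ### Rotations by badly approximable numbers and their itineraries -/

theorem BadlyApproximable.exists_div_le_abs_mul_sub {α : ℝ} (h : BadlyApproximable α) :
    ∃ c : ℝ, 0 < c ∧ ∀ (m : ℤ) (q : ℕ), 1 ≤ q → c / q ≤ |q * α - m| := by
  obtain ⟨c, hc, h⟩ := h
  refine ⟨c, hc, fun m q hq => ?_⟩
  have hq0 : (0 : ℝ) < q := by exact_mod_cast hq
  have h1 := mul_le_mul_of_nonneg_left (h m q hq) hq0.le
  rw [← abs_of_pos hq0, ← abs_mul, abs_of_pos hq0] at h1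
  have e1 : (q : ℝ) * (c / (q : ℝ) ^ 2) = c / q := by field_simp
  have e2 : (q : ℝ) * (α - m / q) = q * α - m := by field_simp
  rwa [e1, e2] at h1

theorem BadlyApproximable.neg {α : ℝ} (h : BadlyApproximable α) : BadlyApproximable (-α) := by
  obtain ⟨c, hc, h⟩ := h
  refine ⟨c, hc, fun p q hq => (h (-p) q hq).trans_eq ?_⟩
  rw [← abs_neg]
  push_cast
  congr 1
  ring

/-- The orbits of the rotation by a badly approximable number hit every interval of length `δ`
within time `O(1 / δ)`. -/
theorem exists_rotation_mem_interval {β c : ℝ} (hc : 0 < c)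
    (hβ : ∀ (m : ℤ) (q : ℕ), 1 ≤ q → c / q ≤ |q * β - m|) {δ : ℝ} (hδ : 0 < δ) (hδ1 : δ ≤ 1)
    (y z : ℝ) :
    ∃ (j : ℕ) (m : ℤ), j * δ ≤ 3 / c + 1 ∧ z < y + j * β - m ∧ y + j * β - m < z + δ := by
  -- Bad approximability gives the Dirichlet denominator `q ≥ c (Q + 1) > 3 / δ`, so the total error
  -- `1/(Q+1) + 1/(2q) ≤ 3/(2q)` is below `δ / 2`.
  set Q : ℕ := ⌈3 / (c * δ)⌉₊ with hQ
  have hpos : 0 < 3 / (c * δ) := by positivity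
  have hQpos : 0 < Q := Nat.ceil_pos.2 hpos
  obtain ⟨x, hx, hden⟩ := Real.exists_rat_abs_sub_le_and_den_le β hQpos
  set q := x.den with hq
  have hq1 : 1 ≤ q := x.pos
  have hq0 : (0 : ℝ) < q := by exact_mod_cast hq1
  have hx' : (x : ℝ) = x.num / q := by exact_mod_cast (Rat.num_div_den x).symm
  have hQ0 : (0 : ℝ) < (Q : ℝ) + 1 := by positivity
  have hlow : c * (Q + 1) ≤ q := by
    have h1 := hβ x.num q hq1
    have h2 : (q : ℝ) * β - x.num = q * (β - x) := by rw [hx']; field_simp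
    rw [h2, abs_mul, abs_of_pos hq0] at h1
    have h3 := mul_le_mul_of_nonneg_left hx hq0.le
    have h4 : (q : ℝ) * (1 / ((Q + 1) * q)) = 1 / (Q + 1) := by field_simp
    rw [h4] at h3
    have h5 := h1.trans h3
    rw [div_le_div_iff₀ hq0 hQ0] at h5
    linarith
  set w := z + δ / 2 - y with hw
  set N : ℤ := round (q * w) with hN
  have hNw : |N / q - w| ≤ 1 / (2 * q) := by
    have h1 : |q * w - N| ≤ 1 / 2 := abs_sub_round _
    have h2 : (N : ℝ) / q - w = -(q * w - N) / q := by field_simp; ring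
    rw [h2, abs_div, abs_neg, abs_of_pos hq0, div_le_div_iff₀ hq0 (by positivity)]
    nlinarith
  -- The multiples of `x.num / q` run through all multiples of `1 / q` modulo 1; `j` comes from
  -- inverting `x.num` modulo `q`.
  obtain ⟨j, m, hj, hjm⟩ : ∃ (j : ℕ) (m : ℤ), j < q ∧ (j : ℤ) * x.num = N + q * m := by
    have hcop : IsCoprime x.num (q : ℤ) := by
      rw [Int.isCoprime_iff_gcd_eq_one]
      simpa [Int.gcd, Nat.Coprime] using x.reduced
    obtain ⟨a, b, hab⟩ := hcop
    have hqz : (q : ℤ) ≠ 0 := by exact_mod_cast (Nat.one_le_iff_ne_zero.1 hq1)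
    refine ⟨((N * a) % q).toNat, -((N * a) / q * x.num) - N * b, ?_, ?_⟩
    · have := Int.emod_lt_of_pos (N * a) (by exact_mod_cast hq1 : (0 : ℤ) < q)
      have := Int.emod_nonneg (N * a) hqz
      omega
    · rw [Int.toNat_of_nonneg (Int.emod_nonneg _ hqz)]
      have h1 : N * a % q = N * a - q * (N * a / q) := by
        have := Int.emod_add_mul_ediv (N * a) q
        linarith
      rw [h1]
      linear_combination N * hab
  have hjm' : (j : ℝ) * x.num = N + q * m := by exact_mod_cast hjm
  have hjq : (j : ℝ) ≤ q := by exact_mod_cast hj.le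
  have hbound : |j * β - m - w| ≤ 1 / (Q + 1) + 1 / (2 * q) := by
    have h1 : j * β - m - w = j * (β - x) + (N / q - w) := by
      rw [hx']
      have : (j : ℝ) * (x.num / q) = N / q + m := by
        rw [← mul_div_assoc, hjm']; field_simp
      linear_combination this
    rw [h1]
    refine (abs_add_le _ _).trans (add_le_add ?_ hNw)
    rw [abs_mul, abs_of_nonneg (Nat.cast_nonneg j)]
    calc (j : ℝ) * |β - x| ≤ q * (1 / ((Q + 1) * q)) := by gcongr
      _ = 1 / (Q + 1) := by field_simp
  have hQδ : 3 / (c * δ) < Q + 1 := (Nat.le_ceil _).trans_lt (lt_add_one _)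
  have hsmall : 1 / ((Q : ℝ) + 1) + 1 / (2 * q) < δ / 2 := by
    have hqQ : (q : ℝ) ≤ Q + 1 := by
      have : (q : ℝ) ≤ Q := by exact_mod_cast hden
      linarith
    have h1 : 1 / ((Q : ℝ) + 1) ≤ 1 / q := one_div_le_one_div_of_le hq0 hqQ
    have h2 : 1 / (2 * (q : ℝ)) = 1 / q / 2 := by field_simp
    have h3 : 1 / (q : ℝ) < δ / 3 := by
      rw [div_lt_div_iff₀ hq0 (by norm_num)]
      rw [div_lt_iff₀ (by positivity)] at hQδ
      nlinarith
    linarith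
  have habs := abs_lt.1 (hbound.trans_lt hsmall)
  refine ⟨j, m, ?_, by linarith [habs.1], by linarith [habs.2]⟩
  have h1 : (j : ℝ) ≤ Q := by exact_mod_cast hj.le.trans hden
  have h2 : (Q : ℝ) ≤ 3 / (c * δ) + 1 := (Nat.ceil_lt_add_one hpos.le).le
  calc (j : ℝ) * δ ≤ (3 / (c * δ) + 1) * δ := by gcongr; linarith
    _ = 3 / c + δ := by field_simp
    _ ≤ 3 / c + 1 := by linarith

/-- The orbits of `y` and `z` under the rotation by `β` wind around the circle in the same way
for `ℓ` steps. -/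
def SameItinerary (β : ℝ) (ℓ : ℕ) (y z : ℝ) : Prop :=
  ∀ j ≤ ℓ, ⌊y + j * β⌋ - ⌊y⌋ = ⌊z + j * β⌋ - ⌊z⌋

namespace SameItinerary

variable {β : ℝ} {ℓ : ℕ} {y z x : ℝ}

theorem refl (y : ℝ) : SameItinerary β ℓ y y := fun _ _ => rfl

theorem symm (h : SameItinerary β ℓ y z) : SameItinerary β ℓ z y := fun j hj => (h j hj).symm

theorem trans (h : SameItinerary β ℓ x y) (h' : SameItinerary β ℓ y z) :
    SameItinerary β ℓ x z := fun j hj => (h j hj).trans (h' j hj)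

theorem mono {ℓ' : ℕ} (h : SameItinerary β ℓ y z) (hℓ : ℓ' ≤ ℓ) : SameItinerary β ℓ' y z :=
  fun j hj => h j (hj.trans hℓ)

theorem add_int_left (h : SameItinerary β ℓ y z) (m : ℤ) : SameItinerary β ℓ (y + m) z := by
  intro j hj
  have h1 : y + m + j * β = y + j * β + m := by ring
  rw [h1, Int.floor_add_intCast, Int.floor_add_intCast, ← h j hj]
  ring

theorem shift (h : SameItinerary β (ℓ + 1) y z) : SameItinerary β ℓ (y + β) (z + β) := by
  intro j hj
  have h1 := h (j + 1) (by omega)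
  have h2 := h 1 (by omega)
  push_cast at h1 h2
  rw [one_mul] at h2
  have e1 : y + β + j * β = y + (j + 1) * β := by ring
  have e2 : z + β + j * β = z + (j + 1) * β := by ring
  rw [e1, e2]
  linarith

end SameItinerary

/-- The set of points with the same itinerary of length `ℓ` as `y` contains an interval of length
of order `1 / ℓ`. -/
theorem exists_interval_sameItinerary {β c : ℝ} (hc : 0 < c)
    (hβ : ∀ (m : ℤ) (q : ℕ), 1 ≤ q → c / q ≤ |q * β - m|) {ℓ : ℕ} (hℓ : 1 ≤ ℓ) (y : ℝ) :
    ∃ a : ℝ, ∀ z, a < z → z < a + min c 1 / ℓ → SameItinerary β ℓ z y := by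
  set f : ℕ → ℝ := fun j => Int.fract (y + j * β) with hf
  have hne : (Finset.range (ℓ + 1)).Nonempty := ⟨0, by simp⟩
  obtain ⟨i, hi, himin⟩ := Finset.exists_min_image (Finset.range (ℓ + 1)) f hne
  obtain ⟨k, hk, hkmax⟩ := Finset.exists_max_image (Finset.range (ℓ + 1)) f hne
  rw [Finset.mem_range] at hi hk
  have hℓ0 : (0 : ℝ) < ℓ := by exact_mod_cast hℓ
  have hfi : 0 ≤ f i := Int.fract_nonneg _
  have hfk : f k < 1 := Int.fract_lt_one _
  -- The gap across 0 between the largest and the smallest fractional part is congruent to a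
  -- multiple of `β` modulo 1, or equals 1 when `i = k`.
  have hgap : min c 1 / ℓ ≤ f i - f k + 1 := by
    have key : ∀ a b : ℕ, a < b → b ≤ ℓ → min c 1 / ℓ ≤ |f a - f b + 1| ∧
        min c 1 / ℓ ≤ |f b - f a + 1| := by
      intro a b hab hb
      have hq : 1 ≤ b - a := by omega
      have hle : ∀ m : ℤ, min c 1 / ℓ ≤ |((b - a : ℕ) : ℝ) * β - m| := fun m => by
        refine le_trans ?_ (hβ m (b - a) hq)
        have : ((b - a : ℕ) : ℝ) ≤ ℓ := by exact_mod_cast (by omega : b - a ≤ ℓ)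
        have h0 : (0 : ℝ) < ((b - a : ℕ) : ℝ) := by exact_mod_cast hq
        gcongr
        exact min_le_left _ _
      have e : ((b - a : ℕ) : ℝ) = b - a := by push_cast [hab.le]; ring
      constructor
      · refine (hle (⌊y + b * β⌋ - ⌊y + a * β⌋ + 1)).trans_eq ?_
        rw [← abs_neg, e]
        congr 1
        simp only [hf, Int.fract]
        push_cast
        ring
      · refine (hle (⌊y + b * β⌋ - ⌊y + a * β⌋ - 1)).trans_eq ?_
        rw [e]
        congr 1
        simp only [hf, Int.fract]
        push_cast
        ring
    have hnn : 0 ≤ f i - f k + 1 := by linarith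
    rcases lt_trichotomy i k with h | h | h
    · simpa [abs_of_nonneg hnn] using (key i k h (by omega)).1
    · subst h
      rw [sub_self, zero_add, div_le_one hℓ0]
      exact (min_le_right _ _).trans (by exact_mod_cast hℓ)
    · simpa [abs_of_nonneg hnn] using (key k i h (by omega)).2
  refine ⟨y - f i, fun z hz1 hz2 => ?_⟩
  have hfloor : ∀ j ≤ ℓ, ⌊z + j * β⌋ = ⌊y + j * β⌋ := by
    intro j hj
    have h1 := himin j (by simp; omega)
    have h2 := hkmax j (by simp; omega)
    have h3 : f j = y + j * β - ⌊y + j * β⌋ := rfl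
    rw [Int.floor_eq_iff]
    constructor <;> linarith
  intro j hj
  have h0 := hfloor 0 (by omega)
  simp only [Nat.cast_zero, zero_mul, add_zero] at h0
  rw [hfloor j hj, h0]

/-- Each itinerary class of length `ℓ` contains an interval of length of order `1 / ℓ`, which every
rotation orbit hits in time `O(ℓ)`. -/
theorem exists_forall_sameItinerary {β c : ℝ} (hc : 0 < c)
    (hβ : ∀ (m : ℤ) (q : ℕ), 1 ≤ q → c / q ≤ |q * β - m|) :
    ∃ R : ℕ, ∀ ℓ : ℕ, 1 ≤ ℓ → ∀ y z : ℝ, ∃ j ≤ R * ℓ, SameItinerary β ℓ (y + j * β) z := by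
  have hκ : 0 < min c 1 := lt_min hc one_pos
  refine ⟨⌈(3 / c + 1) / min c 1⌉₊, fun ℓ hℓ y z => ?_⟩
  have hℓ0 : (0 : ℝ) < ℓ := by exact_mod_cast hℓ
  obtain ⟨a, ha⟩ := exists_interval_sameItinerary hc hβ hℓ z
  obtain ⟨j, m, hj, h1, h2⟩ := exists_rotation_mem_interval hc hβ
    (δ := min c 1 / ℓ) (by positivity)
    ((div_le_one hℓ0).2 ((min_le_right _ _).trans (by exact_mod_cast hℓ))) y a
  refine ⟨j, ?_, ?_⟩
  · have h3 : (j : ℝ) ≤ (3 / c + 1) / min c 1 * ℓ := by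
      rw [div_mul_eq_mul_div, le_div_iff₀ hκ]
      rw [mul_div_assoc', div_le_iff₀ hℓ0] at hj
      exact hj
    have h4 := Nat.le_ceil ((3 / c + 1) / min c 1)
    have h5 : (j : ℝ) ≤ ⌈(3 / c + 1) / min c 1⌉₊ * ℓ := h3.trans (by gcongr)
    exact_mod_cast h5
  · have := (ha _ h1 h2).add_int_left m
    simpa using this

/-- If `z` were further away, some rotate of `[y, z]` within `ℓ` steps would contain an integer that
separates the itineraries. So itinerary classes have length `O(1 / ℓ)`. -/
theorem SameItinerary.lt_add {β c : ℝ} (hc : 0 < c)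
    (hβ : ∀ (m : ℤ) (q : ℕ), 1 ≤ q → c / q ≤ |q * β - m|) {δ : ℝ} (hδ : 0 < δ) (hδ1 : δ ≤ 1)
    {ℓ : ℕ} (hℓ : 3 / c + 1 ≤ ℓ * δ) {y z : ℝ} (hyz : ⌊y⌋ = ⌊z⌋) (h : SameItinerary β ℓ y z) :
    z < y + δ := by
  by_contra! hlt
  obtain ⟨j, m, hj, h1, h2⟩ := exists_rotation_mem_interval hc hβ hδ hδ1 0 (-z)
  have hjℓ : j ≤ ℓ := by
    have : (j : ℝ) ≤ ℓ := le_of_mul_le_mul_right (hj.trans hℓ) hδ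
    exact_mod_cast this
  have h3 := h j hjℓ
  have h4 : ⌊y + j * β⌋ < m := Int.floor_lt.2 (by linarith)
  have h5 : m ≤ ⌊z + j * β⌋ := Int.le_floor.2 (by linarith)
  omega

theorem BadlyApproximable.irrational {α : ℝ} (h : BadlyApproximable α) : Irrational α := by
  obtain ⟨c, hc, h⟩ := h
  rintro ⟨x, rfl⟩
  have h1 := h x.num x.den x.pos
  have h2 : (x : ℝ) = x.num / x.den := by exact_mod_cast (Rat.num_div_den x).symm
  have h3 : (0 : ℝ) < x.den := by exact_mod_cast x.pos
  rw [← h2, sub_self, abs_zero] at h1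
  exact absurd h1 (not_le.2 (by positivity))

theorem Irrational.eq_of_mul_add_int {β : ℝ} (hβ : Irrational β) {a b : ℕ} {m n : ℤ}
    (h : a * β + m = b * β + n) : a = b := by
  by_contra hab
  have h1 : ((a - b : ℤ) : ℝ) * β = (n - m : ℤ) := by push_cast; linarith
  exact (hβ.intCast_mul (by omega : (a - b : ℤ) ≠ 0)).ne_int (n - m) h1

theorem eventually_floor_eq {x : ℝ} (hx : ∀ m : ℤ, x ≠ m) : ∀ᶠ z in 𝓝 x, ⌊z⌋ = ⌊x⌋ := by
  have h1 : (⌊x⌋ : ℝ) < x := lt_of_le_of_ne (Int.floor_le x) (hx _).symm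
  filter_upwards [Ioo_mem_nhds h1 (Int.lt_floor_add_one x)] with z hz
  exact Int.floor_eq_iff.2 ⟨hz.1.le, hz.2⟩

theorem eventually_sameItinerary {β : ℝ} {ℓ : ℕ} {y : ℝ}
    (hy : ∀ j ≤ ℓ, ∀ m : ℤ, y + j * β ≠ m) : ∀ᶠ z in 𝓝 y, SameItinerary β ℓ z y := by
  have h : ∀ j ≤ ℓ, ∀ᶠ z in 𝓝 y, ⌊z + j * β⌋ = ⌊y + j * β⌋ := fun j hj =>
    (by fun_prop : Continuous fun z : ℝ => z + j * β).continuousAt.eventually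
      (eventually_floor_eq (hy j hj))
  have h' : ∀ᶠ z in 𝓝 y, ∀ j ∈ Finset.range (ℓ + 1), ⌊z + j * β⌋ = ⌊y + j * β⌋ := by
    rw [Filter.eventually_all_finset]
    exact fun j hj => h j (by simpa [Nat.lt_succ_iff] using hj)
  filter_upwards [h'] with z hz j hj
  have h0 := hz 0 (by simp)
  simp only [Nat.cast_zero, zero_mul, add_zero] at h0
  rw [hz j (by simp; omega), h0]

/-! ### Linear recurrence of skew products with finite fibre -/

section Skew

variable {S : Type*} (r w : Equiv.Perm S) (β : ℝ)

/-- The two permutations together preserve no proper nonempty set. -/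
def IsTransitivePair (r w : Equiv.Perm S) : Prop :=
  ∀ U : Set S, U.Nonempty → r ∈ MulAction.stabilizer (Equiv.Perm S) U →
    w ∈ MulAction.stabilizer (Equiv.Perm S) U → U = Set.univ

/-- The permutation of the fibre over `y` in the skew product over the rotation by `β`. -/
noncomputable def fibrePerm (y : ℝ) : Equiv.Perm S := r * w ^ (⌊y + β⌋ - ⌊y⌋)

variable {r w β}

/-- A family of sets over the circle which is invariant under the skew product, and which is
determined by itineraries of bounded length, is constant. -/
theorem eq_of_invariant_of_sameItinerary (hirr : Irrational β) {V : ℝ → Set S} {ℓ : ℕ}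
    (hper : ∀ (y : ℝ) (m : ℤ), V (y + m) = V y)
    (hcongr : ∀ y z, SameItinerary β ℓ y z → V y = V z)
    (hinv : ∀ y, V (y + β) = fibrePerm r w β y '' V y) {y z : ℝ}
    (hy : y ∈ Set.Ioo (0 : ℝ) 1) (hz : z ∈ Set.Ioo (0 : ℝ) 1) : V y = V z := by
  have hgen : ∀ y : ℝ, (∀ j ≤ ℓ, ∀ m : ℤ, y + j * β ≠ m) → ∀ᶠ z in 𝓝 y, V z = V y := fun y hy =>
    (eventually_sameItinerary hy).mono fun z hz => hcongr z y hz
  have hshift : ∀ y : ℝ, (∀ m : ℤ, y ≠ m) → (∀ m : ℤ, y + β ≠ m) → (∀ᶠ z in 𝓝 y, V z = V y) →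
      ∀ᶠ z in 𝓝 (y + β), V z = V (y + β) := by
    intro y h0 h1 h2
    have h3 : ∀ᶠ z in 𝓝 y, V (z + β) = V (y + β) := by
      filter_upwards [h2, eventually_floor_eq h0,
        (by fun_prop : Continuous fun z : ℝ => z + β).continuousAt.eventually
          (eventually_floor_eq h1)] with z hz1 hz2 hz3
      rw [hinv, hinv, hz1]
      simp only [fibrePerm, hz2, hz3]
    have h4 : Tendsto (fun z : ℝ => z - β) (𝓝 (y + β)) (𝓝 y) := by
      have : Tendsto (fun z : ℝ => z - β) (𝓝 (y + β)) (𝓝 (y + β - β)) :=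
        (by fun_prop : Continuous fun z : ℝ => z - β).continuousAt
      simpa using this
    simpa using h4.eventually h3
  -- Jumps could occur only at `-jβ` with `j ≤ ℓ`, modulo 1. There is none at `-(ℓ+1)β`, and
  -- invariance carries this forward to `-ℓβ, …, -β`, stopping before the genuine discontinuity at
  -- 0.
  have hcut : ∀ i ≤ ℓ, ∀ᶠ z in 𝓝 (-((ℓ + 1 - i : ℕ) * β)),
      V z = V (-((ℓ + 1 - i : ℕ) * β)) := by
    have hne : ∀ a b : ℕ, a ≠ b → ∀ m : ℤ, -(a * β) + b * β ≠ m := fun a b hab m h =>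
      hab (hirr.eq_of_mul_add_int (m := m) (n := 0) (by push_cast; linarith))
    intro i
    induction i with
    | zero =>
      intro _
      exact hgen _ fun j hj m => hne _ _ (by omega) m
    | succ i ih =>
      intro hi
      have e : -((ℓ + 1 - (i + 1) : ℕ) * β) = -((ℓ + 1 - i : ℕ) * β) + β := by
        have : ℓ + 1 - i = (ℓ + 1 - (i + 1)) + 1 := by omega
        rw [this]; push_cast; ring
      rw [e]
      refine hshift _ (fun m h => ?_) (fun m h => ?_) (ih (by omega))
      · exact hne (ℓ + 1 - i) 0 (by omega) m (by simpa using h)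
      · exact hne (ℓ + 1 - i) 1 (by omega) m (by simpa using h)
  have hloc : ∀ y ∈ Set.Ioo (0 : ℝ) 1, ∀ᶠ z in 𝓝 y, V z = V y := by
    intro y hy
    by_cases h : ∀ j ≤ ℓ, ∀ m : ℤ, y + j * β ≠ m
    · exact hgen y h
    push Not at h
    obtain ⟨j, hj, m, hm⟩ := h
    have hj0 : j ≠ 0 := by
      rintro rfl
      simp only [Nat.cast_zero, zero_mul, add_zero] at hm
      subst hm
      have h1 : (0 : ℤ) < m := by exact_mod_cast hy.1
      have h2 : m < (1 : ℤ) := by exact_mod_cast hy.2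
      omega
    have h1 := hcut (ℓ + 1 - j) (by omega)
    rw [show ℓ + 1 - (ℓ + 1 - j) = j by omega] at h1
    have e : -(j * β) = y - m := by linarith
    rw [e] at h1
    have h2 : Tendsto (fun z : ℝ => z - m) (𝓝 y) (𝓝 (y - m)) :=
      (by fun_prop : Continuous fun z : ℝ => z - m).continuousAt
    refine (h2.eventually h1).mono fun z hz => ?_
    have h3 := hper (z - m) m
    have h4 := hper (y - m) m
    rw [sub_add_cancel] at h3 h4
    rw [h3, h4, hz]
  have hconst : IsLocallyConstant fun z : Set.Ioo (0 : ℝ) 1 => V z := by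
    rw [IsLocallyConstant.iff_eventually_eq]
    intro z
    exact continuous_subtype_val.continuousAt.eventually (hloc z z.2)
  have : PreconnectedSpace (Set.Ioo (0 : ℝ) 1) :=
    Subtype.preconnectedSpace isPreconnected_Ioo
  exact hconst.apply_eq_of_preconnectedSpace ⟨y, hy⟩ ⟨z, hz⟩

/-- The skew product over an irrational rotation has no proper invariant family of sets which is
determined by itineraries of bounded length. -/
theorem eq_univ_of_invariant_of_sameItinerary (hirr : Irrational β)
    (htrans : IsTransitivePair r w) {V : ℝ → Set S} {ℓ : ℕ}
    (hper : ∀ (y : ℝ) (m : ℤ), V (y + m) = V y)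
    (hcongr : ∀ y z, SameItinerary β ℓ y z → V y = V z)
    (hinv : ∀ y, V (y + β) = fibrePerm r w β y '' V y) {y : ℝ}
    (hy : y ∈ Set.Ioo (0 : ℝ) 1) (hne : (V y).Nonempty) : V y = Set.univ := by
  have hconst : ∀ z ∈ Set.Ioo (0 : ℝ) 1, V z = V y := fun z hz =>
    eq_of_invariant_of_sameItinerary hirr hper hcongr hinv hz hy
  have hf0 : 0 < Int.fract β := by
    rw [Int.fract_pos]
    exact hirr.ne_int _
  have hf1 : Int.fract β < 1 := Int.fract_lt_one β
  have hfe : Int.fract β = β - ⌊β⌋ := rfl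
  have hstab : ∀ z ∈ Set.Ioo (0 : ℝ) 1, ∀ m : ℤ, (m : ℝ) < z + β → z + β < m + 1 →
      r * w ^ m ∈ MulAction.stabilizer (Equiv.Perm S) (V y) := by
    intro z hz m h1 h2
    have hz0 : ⌊z⌋ = 0 := Int.floor_eq_zero_iff.2 ⟨hz.1.le, hz.2⟩
    have hzm : ⌊z + β⌋ = m := Int.floor_eq_iff.2 ⟨h1.le, h2⟩
    have h3 := hinv z
    have h4 := hper (z + β) (-m)
    push_cast at h4
    rw [hconst _ ⟨by linarith, by linarith⟩, h3, hconst z hz, eq_comm] at h4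
    rw [MulAction.mem_stabilizer_iff]
    rw [fibrePerm, hz0, hzm, sub_zero] at h4
    exact h4
  -- Both values of the floor increment occur on the unit interval, so the constant set is stable
  -- under `r * w ^ ⌊β⌋` and `r * w ^ (⌊β⌋ + 1)`, hence under `w` and `r`.
  have hj := hstab ((1 - Int.fract β) / 2) ⟨by linarith, by linarith⟩ ⌊β⌋
    (by linarith) (by linarith)
  have hj1 := hstab (1 - Int.fract β / 2) ⟨by linarith, by linarith⟩ (⌊β⌋ + 1)
    (by push_cast; linarith) (by push_cast; linarith)
  have hw : w ∈ MulAction.stabilizer (Equiv.Perm S) (V y) := by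
    have := mul_mem (inv_mem hj) hj1
    rwa [zpow_add_one, ← mul_assoc r, inv_mul_cancel_left] at this
  have hr : r ∈ MulAction.stabilizer (Equiv.Perm S) (V y) := by
    have := mul_mem hj (inv_mem (zpow_mem hw ⌊β⌋))
    rwa [mul_inv_cancel_right] at this
  exact htrans _ hne hr hw

variable (r w β) in
/-- `s` is the sequence of fibre coordinates of the orbit starting over `y₀` of the skew product
over the rotation by `β`. -/
def IsSkewOrbit (y₀ : ℝ) (s : ℕ → S) : Prop :=
  ∀ k : ℕ, s (k + 1) = fibrePerm r w β (y₀ + k * β) (s k)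

variable (β) in
/-- The fibre coordinates at which the orbit `s` follows the itinerary of `y` for `ℓ` steps within
the first `M` steps. -/
def visited (y₀ : ℝ) (s : ℕ → S) (M ℓ : ℕ) (y : ℝ) : Set S :=
  {x | ∃ k : ℕ, k + ℓ ≤ M ∧ SameItinerary β ℓ (y₀ + k * β) y ∧ s k = x}

variable {y₀ : ℝ} {s : ℕ → S} {M : ℕ}

theorem visited_anti {ℓ ℓ' : ℕ} (h : ℓ ≤ ℓ') (y : ℝ) :
    visited β y₀ s M ℓ' y ⊆ visited β y₀ s M ℓ y := by
  rintro x ⟨k, hk, hE, rfl⟩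
  exact ⟨k, by omega, hE.mono h, rfl⟩

theorem visited_congr {ℓ : ℕ} {y z : ℝ} (h : SameItinerary β ℓ y z) :
    visited β y₀ s M ℓ y = visited β y₀ s M ℓ z := by
  ext x
  exact ⟨fun ⟨k, hk, hE, hx⟩ => ⟨k, hk, hE.trans h, hx⟩,
    fun ⟨k, hk, hE, hx⟩ => ⟨k, hk, hE.trans h.symm, hx⟩⟩

/-- One step of the dynamics uses up one step of the itinerary; the fibre permutation depends only
on that first step. -/
theorem visited_shift (hs : IsSkewOrbit r w β y₀ s) (ℓ : ℕ) (y : ℝ) :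
    fibrePerm r w β y '' visited β y₀ s M (ℓ + 1) y ⊆ visited β y₀ s M ℓ (y + β) := by
  rintro _ ⟨_, ⟨k, hk, hE, rfl⟩, rfl⟩
  refine ⟨k + 1, by omega, ?_, ?_⟩
  · have := hE.shift
    push_cast
    rwa [add_mul, one_mul, ← add_assoc]
  · rw [hs k]
    have := hE 1 (by omega)
    simp only [Nat.cast_one, one_mul] at this
    simp only [fibrePerm, this]

theorem ncard_visited_add_le [Finite S] (hs : IsSkewOrbit r w β y₀ s) (ℓ j : ℕ) (y : ℝ) :
    (visited β y₀ s M (ℓ + j) y).ncard ≤ (visited β y₀ s M ℓ (y + j * β)).ncard := by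
  induction j generalizing y with
  | zero => simp
  | succ j ih =>
    have h1 := Set.ncard_le_ncard (visited_shift (M := M) hs (ℓ + j) y) (Set.toFinite _)
    rw [Set.ncard_image_of_injective _ (Equiv.injective _)] at h1
    refine h1.trans ((ih (y + β)).trans_eq ?_)
    push_cast
    rw [add_mul, one_mul, add_assoc, add_comm β]

/-- If no smaller set appears at length `(R+2)ℓ`, all sets of length between `(R+1)ℓ` and `(R+2)ℓ`
have the size of the one at `y`: transport to the itinerary of `y` gives the upper bound.
Monotonicity in the length then makes the shift inclusion an equality, that is, invariance. -/
theorem visited_eq_univ_or_exists_ncard_lt [Finite S] (hirr : Irrational β)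
    (htrans : IsTransitivePair r w)
    {R : ℕ} (hR : ∀ ℓ : ℕ, 1 ≤ ℓ → ∀ y z : ℝ, ∃ j ≤ R * ℓ, SameItinerary β ℓ (y + j * β) z)
    (hs : IsSkewOrbit r w β y₀ s) {ℓ : ℕ} (hℓ : 1 ≤ ℓ)
    (hne : ∀ z, (visited β y₀ s M ((R + 2) * ℓ) z).Nonempty) (y : ℝ) :
    (∀ z ∈ Set.Ioo (0 : ℝ) 1, visited β y₀ s M ℓ z = Set.univ) ∨
      ∃ y', (visited β y₀ s M ((R + 2) * ℓ) y').ncard < (visited β y₀ s M ℓ y).ncard := by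
  rw [or_iff_not_imp_right]
  intro hmin
  push Not at hmin
  let V := visited β y₀ s M
  set ℓ' := (R + 1) * ℓ with hℓ'
  have hle : ℓ' + 1 ≤ (R + 2) * ℓ := by rw [hℓ']; nlinarith
  have hupper : ∀ z, (V ℓ' z).ncard ≤ (V ℓ y).ncard := by
    intro z
    obtain ⟨j, hj, hE⟩ := hR ℓ hℓ z y
    have e : V ℓ (z + j * β) = V ℓ y := visited_congr hE
    rw [← e]
    refine le_trans (Set.ncard_le_ncard (visited_anti ?_ z) (Set.toFinite _))
      (ncard_visited_add_le hs ℓ j z)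
    rw [hℓ']; nlinarith
  have hsucc : ∀ z, V (ℓ' + 1) z = V ℓ' z := fun z =>
    Set.eq_of_subset_of_ncard_le (visited_anti (Nat.le_succ _) z)
      ((hupper z).trans ((hmin z).trans
        (Set.ncard_le_ncard (visited_anti hle z) (Set.toFinite _)))) (Set.toFinite _)
  intro z hz
  have hall : V ℓ' z = Set.univ := by
    refine eq_univ_of_invariant_of_sameItinerary (r := r) (w := w) hirr htrans (ℓ := ℓ')
      (fun y m => visited_congr ((SameItinerary.refl y).add_int_left m))
      (fun _ _ h => visited_congr h) (fun x => ?_) hz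
      ((hne z).mono (visited_anti (by omega) z))
    refine (Set.eq_of_subset_of_ncard_le (t := V ℓ' (x + β)) ?_ ?_ (Set.toFinite _)).symm
    · change _ '' V ℓ' x ⊆ _
      rw [← hsucc x]
      exact visited_shift hs ℓ' x
    · rw [Set.ncard_image_of_injective _ (Equiv.injective _)]
      change _ ≤ (V ℓ' x).ncard
      rw [← hsucc x]
      exact (hupper _).trans ((hmin x).trans
        (Set.ncard_le_ncard (visited_anti hle x) (Set.toFinite _)))
  exact Set.univ_subset_iff.1 (hall ▸ visited_anti (by rw [hℓ']; nlinarith) z)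

variable (r w) in
/-- Linear recurrence of the skew product over the rotation by a badly approximable number. -/
theorem exists_visited_eq_univ [Finite S] (hβ : BadlyApproximable β)
    (htrans : IsTransitivePair r w) :
    ∃ K : ℕ, ∀ (y₀ : ℝ) (s : ℕ → S), IsSkewOrbit r w β y₀ s → ∀ ℓ : ℕ, 1 ≤ ℓ →
      ∀ y ∈ Set.Ioo (0 : ℝ) 1, visited β y₀ s (K * ℓ) ℓ y = Set.univ := by
  obtain ⟨c, hc, hc'⟩ := hβ.exists_div_le_abs_mul_sub
  obtain ⟨R, hR⟩ := exists_forall_sameItinerary hc hc'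
  set N := Nat.card S
  -- The window is long enough to meet every itinerary of length `(R+2)^i ℓ` with `i ≤ N`. Otherwise
  -- `N` successive drops from size at most `N` would empty a nonempty set.
  refine ⟨(R + 1) * (R + 2) ^ N, fun y₀ s hs ℓ hℓ y hy => ?_⟩
  by_contra hnot
  have hpow : ∀ i, 1 ≤ (R + 2) ^ i * ℓ := fun i => Nat.mul_pos (by positivity) hℓ
  have hmono : ∀ i ≤ N, (R + 2) ^ i * ℓ ≤ (R + 2) ^ N * ℓ := fun i hi =>
    Nat.mul_le_mul_right _ (Nat.pow_le_pow_right (by omega) hi)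
  have hne : ∀ i ≤ N, ∀ z, (visited β y₀ s ((R + 1) * (R + 2) ^ N * ℓ)
      ((R + 2) ^ i * ℓ) z).Nonempty := by
    intro i hi z
    obtain ⟨j, hj, hE⟩ := hR _ (hpow i) y₀ z
    refine ⟨s j, j, ?_, hE, rfl⟩
    have h1 := hmono i hi
    calc j + (R + 2) ^ i * ℓ ≤ (R + 1) * ((R + 2) ^ i * ℓ) := by linarith
      _ ≤ (R + 1) * ((R + 2) ^ N * ℓ) := Nat.mul_le_mul_left _ h1
      _ = _ := by ring
  have hstep : ∀ i ≤ N, ∃ z, (visited β y₀ s ((R + 1) * (R + 2) ^ N * ℓ)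
      ((R + 2) ^ i * ℓ) z).ncard + i ≤ N := by
    intro i
    induction i with
    | zero =>
      intro _
      refine ⟨y, ?_⟩
      rw [add_zero]
      exact Set.ncard_le_card _
    | succ i ih =>
      intro hi
      obtain ⟨z, hz⟩ := ih (by omega)
      have e : (R + 2) * ((R + 2) ^ i * ℓ) = (R + 2) ^ (i + 1) * ℓ := by ring
      rcases visited_eq_univ_or_exists_ncard_lt hβ.irrational htrans hR hs (hpow i)
        (e ▸ hne (i + 1) hi) z with h | ⟨z', hz'⟩
      · refine absurd (Set.univ_subset_iff.1 (h y hy ▸ visited_anti ?_ y)) hnot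
        exact Nat.le_mul_of_pos_left _ (by positivity)
      · rw [e] at hz'
        exact ⟨z', by omega⟩
  obtain ⟨z, hz⟩ := hstep N le_rfl
  have h0 := (Set.ncard_pos (Set.toFinite _)).2 (hne N le_rfl z)
  omega

variable (r w) in
/-- The orbits of the skew product over the rotation by a badly approximable number reach every
interval of length `δ` in every fibre within time `O(1 / δ)`. -/
theorem exists_skewOrbit_mem_interval [Finite S] (hβ : BadlyApproximable β)
    (htrans : IsTransitivePair r w) :
    ∃ C : ℝ, 0 < C ∧ ∀ (y₀ : ℝ) (s : ℕ → S), IsSkewOrbit r w β y₀ s → ∀ δ : ℝ, 0 < δ → δ ≤ 1 →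
      ∀ (a : ℝ) (x : S), 0 ≤ a → a + δ ≤ 1 →
        ∃ k : ℕ, k * δ ≤ C ∧ s k = x ∧ Int.fract (y₀ + k * β) ∈ Set.Ioo a (a + δ) := by
  obtain ⟨c, hc, hc'⟩ := hβ.exists_div_le_abs_mul_sub
  obtain ⟨K, hK⟩ := exists_visited_eq_univ r w hβ htrans
  have hpos : 0 < 3 / c + 1 := by positivity
  refine ⟨(K + 1) * (2 * (3 / c + 1) + 1), by positivity, fun y₀ s hs δ hδ hδ1 a x ha hb => ?_⟩
  set ℓ := ⌈(3 / c + 1) / (δ / 2)⌉₊ with hℓdef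
  have hℓ1 : 1 ≤ ℓ := Nat.ceil_pos.2 (by positivity)
  have hℓ : 3 / c + 1 ≤ ℓ * (δ / 2) := by
    rw [← div_le_iff₀ (by positivity)]
    exact Nat.le_ceil _
  have hℓ' : (ℓ : ℝ) * δ ≤ 2 * (3 / c + 1) + 1 := by
    have h1 : (ℓ : ℝ) < (3 / c + 1) / (δ / 2) + 1 := Nat.ceil_lt_add_one (by positivity)
    have h2 : ((3 / c + 1) / (δ / 2) + 1) * δ = 2 * (3 / c + 1) + δ := by field_simp
    nlinarith
  have hmem : a + δ / 2 ∈ Set.Ioo (0 : ℝ) 1 := ⟨by linarith, by linarith⟩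
  have hx : x ∈ visited β y₀ s (K * ℓ) ℓ (a + δ / 2) := by
    rw [hK y₀ s hs ℓ hℓ1 _ hmem]; trivial
  obtain ⟨k, hk, hE, hsk⟩ := hx
  have hE' : SameItinerary β ℓ (Int.fract (y₀ + k * β)) (a + δ / 2) := by
    have := hE.add_int_left (-⌊y₀ + k * β⌋)
    push_cast at this
    exact this
  have hfl : ⌊Int.fract (y₀ + k * β)⌋ = ⌊a + δ / 2⌋ := by
    rw [Int.floor_fract, eq_comm, Int.floor_eq_zero_iff]
    exact ⟨hmem.1.le, hmem.2⟩
  have h1 := hE'.lt_add hc hc' (by linarith) (by linarith) hℓ hfl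
  have h2 := hE'.symm.lt_add hc hc' (by linarith) (by linarith) hℓ hfl.symm
  refine ⟨k, ?_, hsk, by linarith, by linarith⟩
  have h3 : (k : ℝ) ≤ K * ℓ := by exact_mod_cast (by omega : k ≤ K * ℓ)
  calc (k : ℝ) * δ ≤ K * ℓ * δ := by gcongr
    _ = K * (ℓ * δ) := by ring
    _ ≤ (K + 1) * (2 * (3 / c + 1) + 1) := by
      gcongr
      linarith

end Skew

/-! ### Torus characters on the surface, and necessity -/

/-- Geodesics are described only by segments just after and just before each time; connectedness of
the interval turns such one-sided information into global invariants. -/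
theorem eq_of_eventually_eq_nhdsGT_nhdsLT {A : Type*} {g : ℝ → A} {a b : ℝ} (hab : a ≤ b)
    (hf : ∀ t ∈ Set.Ico a b, ∀ᶠ z in 𝓝[>] t, g z = g t)
    (hb : ∀ t ∈ Set.Ioc a b, ∀ᶠ z in 𝓝[<] t, g z = g t) : g b = g a := by
  have hconst : IsLocallyConstant fun z : Set.Icc a b => g z := by
    rw [IsLocallyConstant.iff_eventually_eq]
    rintro ⟨t, ht⟩
    have h1 : ∀ᶠ z in 𝓝 t, t < z → z ∈ Set.Icc a b → g z = g t := by
      rcases ht.2.lt_or_eq with h | h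
      · exact (eventually_nhdsWithin_iff.1 (hf t ⟨ht.1, h⟩)).mono fun z hz h _ => hz h
      · exact Eventually.of_forall fun z hz hz' => absurd hz'.2 (by linarith)
    have h2 : ∀ᶠ z in 𝓝 t, z < t → z ∈ Set.Icc a b → g z = g t := by
      rcases ht.1.lt_or_eq with h | h
      · exact (eventually_nhdsWithin_iff.1 (hb t ⟨h, ht.2⟩)).mono fun z hz h _ => hz h
      · exact Eventually.of_forall fun z hz hz' => absurd hz'.1 (by linarith)
    have h3 : ∀ᶠ z in 𝓝 t, z ∈ Set.Icc a b → g z = g t := by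
      filter_upwards [h1, h2] with z hz1 hz2 hz
      rcases lt_trichotomy z t with h | h | h
      · exact hz2 h hz
      · rw [h]
      · exact hz1 h hz
    exact (continuous_subtype_val.continuousAt.eventually h3).mono fun z hz => hz z.2
  have : PreconnectedSpace (Set.Icc a b) := Subtype.preconnectedSpace isPreconnected_Icc
  exact hconst.apply_eq_of_preconnectedSpace ⟨b, hab, le_rfl⟩ ⟨a, le_rfl, hab⟩

/-- The point of the unit square with the given coordinates. -/
noncomputable def unitSquare.mk (a b : ℝ) (ha : a ∈ Set.Icc (0 : ℝ) 1)
    (hb : b ∈ Set.Icc (0 : ℝ) 1) : unitSquare :=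
  ⟨!₂[a, b], by intro i; fin_cases i <;> simpa⟩

@[simp] theorem unitSquare.mk_zero {a b : ℝ} (ha : a ∈ Set.Icc (0 : ℝ) 1)
    (hb : b ∈ Set.Icc (0 : ℝ) 1) : (unitSquare.mk a b ha hb).1 0 = a := rfl

@[simp] theorem unitSquare.mk_one {a b : ℝ} (ha : a ∈ Set.Icc (0 : ℝ) 1)
    (hb : b ∈ Set.Icc (0 : ℝ) 1) : (unitSquare.mk a b ha hb).1 1 = b := rfl

theorem unitSquare.ext {x y : unitSquare} (h0 : x.1 0 = y.1 0) (h1 : x.1 1 = y.1 1) : x = y := by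
  apply Subtype.ext
  ext i
  fin_cases i
  · exact h0
  · exact h1

theorem AddCircle.coe_eq_coe_iff_exists_int {a b : ℝ} :
    (a : AddCircle (1 : ℝ)) = b ↔ ∃ m : ℤ, a - b = m := by
  rw [← sub_eq_zero, ← AddCircle.coe_sub, AddCircle.coe_eq_zero_iff]
  exact exists_congr fun m => by rw [zsmul_eq_mul, mul_one, eq_comm]

namespace PolysquareSurface

variable {P : PolysquareSurface}

theorem pt_right (s : P.Square) {x y : unitSquare} (hx : x.1 0 = 1) (hy : y.1 0 = 0)
    (h : y.1 1 = x.1 1) : P.pt s x = P.pt (P.right s) y :=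
  Quot.sound (Or.inl ⟨rfl, hx, hy, h⟩)

theorem pt_up (s : P.Square) {x y : unitSquare} (hx : x.1 1 = 1) (hy : y.1 1 = 0)
    (h : y.1 0 = x.1 0) : P.pt s x = P.pt (P.up s) y :=
  Quot.sound (Or.inr ⟨rfl, hx, hy, h⟩)

theorem JoinedBy.trans {p q z : P.Point} {r r' : ℝ} (h : P.JoinedBy p q r)
    (h' : P.JoinedBy q z r') : P.JoinedBy p z (r + r') := by
  induction h' with
  | refl => simpa using h
  | step s x y _ ih => simpa [add_assoc] using JoinedBy.step s x y ih

theorem joinedBy_pt (s : P.Square) (x y : unitSquare) :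
    P.JoinedBy (P.pt s x) (P.pt s y) (dist x y) := by
  simpa using JoinedBy.step s x y (JoinedBy.refl _)

theorem JoinedBy.nonneg {p q : P.Point} {r : ℝ} (h : P.JoinedBy p q r) : 0 ≤ r := by
  induction h with
  | refl => exact le_rfl
  | step s x y _ ih => exact add_nonneg ih dist_nonneg

theorem JoinedBy.flatDist_le {p q : P.Point} {r : ℝ} (h : P.JoinedBy p q r) :
    P.flatDist p q ≤ r :=
  csInf_le ⟨0, fun _ h => JoinedBy.nonneg h⟩ h

/-- Ensures that the infimum defining `flatDist` is over a nonempty set, so that a small distance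
yields an actual short broken line. -/
theorem exists_joinedBy (p q : P.Point) : ∃ r, P.JoinedBy p q r := by
  have key : ∀ a b : P.Square, Relation.EqvGen (fun a b => b = P.right a ∨ b = P.up a) a b →
      ∀ x y, (∃ r, P.JoinedBy (P.pt a x) (P.pt b y) r) ∧
        ∃ r, P.JoinedBy (P.pt b y) (P.pt a x) r := by
    intro a b h
    induction h with
    | rel a b h =>
      intro x y
      obtain ⟨z, z', h⟩ : ∃ z z', P.pt a z = P.pt b z' := by
        have h0 : (0 : ℝ) ∈ Set.Icc (0 : ℝ) 1 := by simp
        have h1 : (1 : ℝ) ∈ Set.Icc (0 : ℝ) 1 := by simp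
        rcases h with rfl | rfl
        · exact ⟨unitSquare.mk 1 0 h1 h0, unitSquare.mk 0 0 h0 h0, pt_right a rfl rfl rfl⟩
        · exact ⟨unitSquare.mk 0 1 h0 h1, unitSquare.mk 0 0 h0 h0, pt_up a rfl rfl rfl⟩
      exact ⟨⟨_, JoinedBy.trans (h ▸ joinedBy_pt a x z) (joinedBy_pt b z' y)⟩,
        ⟨_, JoinedBy.trans (h ▸ joinedBy_pt b y z') (joinedBy_pt a z x)⟩⟩
    | refl a => exact fun x y => ⟨⟨_, joinedBy_pt a x y⟩, ⟨_, joinedBy_pt a y x⟩⟩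
    | symm a b _ ih => exact fun x y => (ih y x).symm
    | trans a b c _ _ ih ih' =>
      intro x y
      obtain ⟨⟨r, h1⟩, ⟨r', h2⟩⟩ := ih x x
      obtain ⟨⟨l, h3⟩, ⟨l', h4⟩⟩ := ih' x y
      exact ⟨⟨_, h1.trans h3⟩, ⟨_, h4.trans h2⟩⟩
  obtain ⟨⟨s, x⟩, rfl⟩ := Quot.exists_rep p
  obtain ⟨⟨s', x'⟩, rfl⟩ := Quot.exists_rep q
  exact (key s s' (P.connected s s') x x').1

/-- The character `q y - p x` of the square torus, as a function on the surface. -/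
def character (P : PolysquareSurface) (q p : ℤ) : P.Point → AddCircle (1 : ℝ) :=
  Quot.lift (fun z => ((q * z.2.1 1 - p * z.2.1 0 : ℝ) : AddCircle (1 : ℝ))) <| by
    rintro ⟨s, x⟩ ⟨s', x'⟩ (⟨-, h1, h2, h3⟩ | ⟨-, h1, h2, h3⟩)
    · refine AddCircle.coe_eq_coe_iff_exists_int.2 ⟨-p, ?_⟩
      simp only at h1 h2 h3 ⊢
      rw [h1, h2, h3]; push_cast; ring
    · refine AddCircle.coe_eq_coe_iff_exists_int.2 ⟨q, ?_⟩
      simp only at h1 h2 h3 ⊢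
      rw [h1, h2, h3]; ring

theorem character_pt (q p : ℤ) (s : P.Square) (x : unitSquare) :
    P.character q p (P.pt s x) = ((q * x.1 1 - p * x.1 0 : ℝ) : AddCircle (1 : ℝ)) := rfl

theorem JoinedBy.exists_character_eq {z z' : P.Point} {r : ℝ} (h : P.JoinedBy z z' r)
    (q p : ℤ) : ∃ δ : ℝ, |δ| ≤ (|(p : ℝ)| + |(q : ℝ)|) * r ∧
      P.character q p z' = P.character q p z + (δ : AddCircle (1 : ℝ)) := by
  induction h with
  | refl => exact ⟨0, by simp, by simp⟩
  | step s x y _ ih =>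
    obtain ⟨δ, hδ, h⟩ := ih
    have hi : ∀ i, |y.1 i - x.1 i| ≤ dist x y := fun i => by
      rw [dist_comm, Subtype.dist_eq, dist_eq_norm]
      exact PiLp.norm_apply_le (y.1 - x.1) i
    refine ⟨δ + (q * (y.1 1 - x.1 1) - p * (y.1 0 - x.1 0)), ?_, ?_⟩
    · rw [mul_add]
      refine (abs_add_le _ _).trans (add_le_add hδ ((abs_sub _ _).trans ?_))
      rw [abs_mul, abs_mul, add_mul, add_comm]
      gcongr <;> exact hi _
    · rw [AddCircle.coe_add, ← add_assoc, ← h, character_pt, character_pt, ← AddCircle.coe_add]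
      congr 1
      ring

theorem exists_character_eq (P : PolysquareSurface) {q p : ℤ} (h : p ≠ 0 ∨ q ≠ 0) (v : ℝ) :
    ∃ z : P.Point, P.character q p z = (v : AddCircle (1 : ℝ)) := by
  obtain ⟨s⟩ := P.nonempty_square
  have h0 : (0 : ℝ) ∈ Set.Icc (0 : ℝ) 1 := by simp
  have hfr : ∀ a : ℝ, Int.fract a ∈ Set.Icc (0 : ℝ) 1 := fun a =>
    ⟨Int.fract_nonneg a, (Int.fract_lt_one a).le⟩
  rcases h with h | h
  · have h' : (p : ℝ) ≠ 0 := by exact_mod_cast h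
    refine ⟨P.pt s (unitSquare.mk _ 0 (hfr (-v / p)) h0), ?_⟩
    rw [character_pt, AddCircle.coe_eq_coe_iff_exists_int]
    refine ⟨p * ⌊-v / p⌋, ?_⟩
    simp only [unitSquare.mk_one, unitSquare.mk_zero, Int.fract]
    push_cast
    field_simp
    ring
  · have h' : (q : ℝ) ≠ 0 := by exact_mod_cast h
    refine ⟨P.pt s (unitSquare.mk 0 _ h0 (hfr (v / q))), ?_⟩
    rw [character_pt, AddCircle.coe_eq_coe_iff_exists_int]
    refine ⟨-(q * ⌊v / q⌋), ?_⟩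
    simp only [unitSquare.mk_one, unitSquare.mk_zero, Int.fract]
    push_cast
    field_simp
    ring

variable {L : ℝ → P.Point} {u : EuclideanSpace ℝ (Fin 2)}

theorem IsGeodesic.eventually_nhdsGE (hL : P.IsGeodesic L u) {t : ℝ} (ht : 0 ≤ t) :
    ∃ (s : P.Square) (x : unitSquare), ∀ᶠ z in 𝓝[≥] t, ∃ y : unitSquare, L z = P.pt s y ∧
      ∀ i, y.1 i = x.1 i + (z - t) * u i := by
  obtain ⟨ε, hε, s, x, h⟩ := hL.forward t ht
  obtain ⟨h0, -⟩ := h 0 ⟨le_rfl, hε.le⟩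
  rw [zero_smul, add_zero] at h0
  refine ⟨s, ⟨x, h0⟩, ?_⟩
  filter_upwards [Icc_mem_nhdsGE (show t < t + ε by linarith)] with z hz
  obtain ⟨h1, h2⟩ := h (z - t) ⟨by linarith [hz.1], by linarith [hz.2]⟩
  rw [add_sub_cancel] at h2
  exact ⟨⟨_, h1⟩, h2, fun i => by simp⟩

theorem IsGeodesic.eventually_nhdsLE (hL : P.IsGeodesic L u) {t : ℝ} (ht : 0 < t) :
    ∃ (s : P.Square) (x : unitSquare), ∀ᶠ z in 𝓝[≤] t, ∃ y : unitSquare, L z = P.pt s y ∧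
      ∀ i, y.1 i = x.1 i + (z - t) * u i := by
  obtain ⟨ε, hε, -, s, x, h⟩ := hL.backward t ht
  obtain ⟨h0, -⟩ := h 0 ⟨le_rfl, hε.le⟩
  rw [zero_smul, sub_zero] at h0
  refine ⟨s, ⟨x, h0⟩, ?_⟩
  filter_upwards [Icc_mem_nhdsLE (show t - ε < t by linarith)] with z hz
  obtain ⟨h1, h2⟩ := h (t - z) ⟨by linarith [hz.2], by linarith [hz.1]⟩
  rw [sub_sub_cancel] at h2
  exact ⟨⟨_, h1⟩, h2, fun i => by simp; ring⟩

theorem IsGeodesic.character_eq (hL : P.IsGeodesic L u) (q p : ℤ) {t : ℝ} (ht : 0 ≤ t) :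
    P.character q p (L t) =
      P.character q p (L 0) + ((t * (q * u 1 - p * u 0) : ℝ) : AddCircle (1 : ℝ)) := by
  set g : ℝ → AddCircle (1 : ℝ) := fun t =>
    P.character q p (L t) - ((t * (q * u 1 - p * u 0) : ℝ) : AddCircle (1 : ℝ)) with hg
  have key : ∀ (s : P.Square) (t : ℝ) (x : unitSquare) (F : Filter ℝ), pure t ≤ F →
      (∀ᶠ z in F, ∃ y : unitSquare, L z = P.pt s y ∧ ∀ i, y.1 i = x.1 i + (z - t) * u i) →
      ∀ᶠ z in F, g z = g t := by
    intro s t x F hF h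
    have hz : ∀ z, (∃ y : unitSquare, L z = P.pt s y ∧ ∀ i, y.1 i = x.1 i + (z - t) * u i) →
        g z = ((q * x.1 1 - p * x.1 0 - t * (q * u 1 - p * u 0) : ℝ) : AddCircle (1 : ℝ)) := by
      rintro z ⟨y, hy, hi⟩
      simp only [hg, hy, character_pt, hi]
      rw [← AddCircle.coe_sub]
      congr 1
      ring
    have ht := hz t (hF h)
    exact h.mono fun z h => (hz z h).trans ht.symm
  have h0 : g t = g 0 := by
    refine eq_of_eventually_eq_nhdsGT_nhdsLT ht (fun z hz => ?_) (fun z hz => ?_)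
    · obtain ⟨s, x, h⟩ := hL.eventually_nhdsGE hz.1
      exact (key s z x _ (pure_le_nhdsWithin Set.self_mem_Ici) h).filter_mono
        (nhdsWithin_mono _ Set.Ioi_subset_Ici_self)
    · obtain ⟨s, x, h⟩ := hL.eventually_nhdsLE hz.1
      exact (key s z x _ (pure_le_nhdsWithin Set.self_mem_Iic) h).filter_mono
        (nhdsWithin_mono _ Set.Iio_subset_Iic_self)
  simp only [hg, zero_mul, AddCircle.coe_zero, sub_zero] at h0
  rw [← h0, sub_add_cancel]

/-- A superdense geodesic cannot stay close to a closed geodesic of the torus for too long. -/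
theorem IsGeodesic.exists_le_mul_abs_sub (hL : P.IsGeodesic L u) (h : P.Superdense L) :
    ∃ c : ℝ, 0 < c ∧ ∀ p q : ℤ, (p ≠ 0 ∨ q ≠ 0) →
      c ≤ (|(p : ℝ)| + |(q : ℝ)|) * |q * u 1 - p * u 0| := by
  obtain ⟨C, hC, h⟩ := h
  refine ⟨1 / (32 * C), by positivity, fun p q hpq => ?_⟩
  set K : ℕ := p.natAbs + q.natAbs with hK
  have hKr : |(p : ℝ)| + |(q : ℝ)| = K := by
    rw [hK]
    push_cast
    simp
  have hK1 : 1 ≤ K := by omega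
  have hK0 : (0 : ℝ) < K := by exact_mod_cast hK1
  obtain ⟨v, hv⟩ := QuotientAddGroup.mk_surjective (P.character q p (L 0))
  obtain ⟨z, hz⟩ := P.exists_character_eq hpq (v + 1 / 2)
  -- Distance at most `1/(8K)` leaves room for a broken line shorter than `1/(4K)`, which changes
  -- the character by less than `1/4`; motion along the geodesic must supply the rest of the shift
  -- `1/2`.
  obtain ⟨t, ht, hd⟩ := h (8 * K) (by omega) z
  obtain ⟨r, hr, hrlt⟩ := exists_lt_of_csInf_lt (exists_joinedBy (L t) z)
    (hd.trans_lt (show 1 / ((8 * K : ℕ) : ℝ) < 1 / (4 * K) by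
      push_cast
      exact one_div_lt_one_div_of_lt (by positivity) (by linarith)))
  obtain ⟨δ, hδ, hchar⟩ := JoinedBy.exists_character_eq hr q p
  rw [hz, hL.character_eq q p ht.1, ← hv] at hchar
  change ((v + 1 / 2 : ℝ) : AddCircle (1 : ℝ)) = (v : AddCircle (1 : ℝ)) + _ + _ at hchar
  rw [← AddCircle.coe_add, ← AddCircle.coe_add, AddCircle.coe_eq_coe_iff_exists_int] at hchar
  obtain ⟨m, hm⟩ := hchar
  rw [hKr] at hδ ⊢
  have hδ' : |δ| < 1 / 4 := hδ.trans_lt <| by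
    have : (K : ℝ) * (1 / (4 * K)) = 1 / 4 := by field_simp
    rw [← this]
    gcongr
  set θ := (q : ℝ) * u 1 - p * u 0
  have h1 : 1 / 4 ≤ |t * θ| := by
    by_contra! hlt
    have h1 := abs_lt.1 hlt
    have h2 := abs_lt.1 hδ'
    have h3 : (0 : ℝ) < m := by linarith
    have h4 : (m : ℝ) < 1 := by linarith
    have h5 : (0 : ℤ) < m := by exact_mod_cast h3
    have h6 : m < (1 : ℤ) := by exact_mod_cast h4
    omega
  rw [abs_mul, abs_of_nonneg ht.1] at h1
  have h2 := ht.2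
  push_cast at h2
  have h3 : 1 / 4 ≤ C * (8 * K) * |θ| := h1.trans (by gcongr)
  rw [div_le_iff₀ (by positivity)]
  linarith

theorem IsGeodesic.badlyApproximable_of_superdense (hL : P.IsGeodesic L u)
    (h : P.Superdense L) : u 0 ≠ 0 ∧ BadlyApproximable (u 1 / u 0) := by
  obtain ⟨c, hc, h⟩ := hL.exists_le_mul_abs_sub h
  have hu : u 0 ≠ 0 := by
    intro hu
    have := h 1 0 (by simp)
    simp [hu] at this
    linarith
  have hu' : 0 < |u 0| := abs_pos.2 hu
  set α := u 1 / u 0 with hα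
  refine ⟨hu, min 1 (c / ((|α| + 2) * |u 0|)), by positivity, fun p q hq => ?_⟩
  have hq0 : (1 : ℝ) ≤ q := by exact_mod_cast hq
  have hq0' : (0 : ℝ) < q := by linarith
  -- Here `|p| + |q|` is comparable to `q`; in the other case `p / q` is at distance at least 1 from
  -- `α`.
  by_cases hp : |(p : ℝ)| ≤ (|α| + 1) * q
  · have h1 := h p q (Or.inr (by exact_mod_cast (by omega : q ≠ 0)))
    have e : ((q : ℤ) : ℝ) * u 1 - p * u 0 = q * u 0 * (α - p / q) := by
      rw [hα]; push_cast; field_simp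
    rw [e, abs_mul, abs_mul] at h1
    push_cast at h1
    rw [abs_of_pos hq0'] at h1
    have h2 : c ≤ ((|α| + 2) * q) * (q * |u 0| * |α - p / q|) :=
      h1.trans (by gcongr; linarith)
    calc min 1 (c / ((|α| + 2) * |u 0|)) / (q : ℝ) ^ 2
        ≤ c / ((|α| + 2) * |u 0|) / (q : ℝ) ^ 2 := by gcongr; exact min_le_right _ _
      _ ≤ |α - p / q| := by
        rw [div_div, div_le_iff₀ (by positivity)]
        linarith
  · push Not at hp
    calc min 1 (c / ((|α| + 2) * |u 0|)) / (q : ℝ) ^ 2 ≤ 1 / 1 := by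
          gcongr
          · exact min_le_left _ _
          · exact one_le_pow₀ hq0
      _ ≤ |α - p / q| := by
        have h1 : |α| + 1 < |(p : ℝ) / q| := by
          rw [abs_div (p : ℝ), abs_of_pos hq0', lt_div_iff₀ hq0']
          exact hp
        have h2 := abs_sub_abs_le_abs_sub ((p : ℝ) / q) α
        rw [abs_sub_comm] at h2
        linarith

end PolysquareSurface

/-! ### Coding a geodesic by a skew product -/

namespace PolysquareSurface

variable {P : PolysquareSurface}

open Classical in
/-- The square containing a point which is not a vertex, where points on a common edge of two
squares are assigned to the square to the right of or above the edge. -/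
noncomputable def squareOf (P : PolysquareSurface) : P.Point → Option P.Square :=
  Quot.lift (fun z =>
    if (z.2.1 0 = 0 ∨ z.2.1 0 = 1) ∧ (z.2.1 1 = 0 ∨ z.2.1 1 = 1) then none
    else if z.2.1 0 = 1 then some (P.right z.1)
    else if z.2.1 1 = 1 then some (P.up z.1) else some z.1) <| by
    rintro ⟨s, x⟩ ⟨s', x'⟩ (⟨h0, h1, h2, h3⟩ | ⟨h0, h1, h2, h3⟩) <;>
    · simp only at h0 h1 h2 h3 ⊢
      subst h0
      simp only [h1, h2, h3]
      by_cases ha : x.1 0 = 0 <;> by_cases hb : x.1 0 = 1 <;> by_cases hc : x.1 1 = 0 <;>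
        by_cases hd : x.1 1 = 1 <;> simp_all

/-- The point `z`, which lies over the point `(a, b)` of the plane, has the coordinates
`(a - A, b - B)` in the square `s`. -/
def LiesIn (z : P.Point) (a b : ℝ) (s : P.Square) (A B : ℤ) : Prop :=
  ∃ x : unitSquare, z = P.pt s x ∧ x.1 0 = a - A ∧ x.1 1 = b - B

namespace LiesIn

variable {z : P.Point} {a b : ℝ} {s s' : P.Square} {A A' B B' : ℤ}

theorem left_mem (h : LiesIn z a b s A B) : a - A ∈ Set.Icc (0 : ℝ) 1 := by
  obtain ⟨x, -, h, -⟩ := h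
  exact h ▸ x.2 0

theorem right_mem (h : LiesIn z a b s A B) : b - B ∈ Set.Icc (0 : ℝ) 1 := by
  obtain ⟨x, -, -, h⟩ := h
  exact h ▸ x.2 1

theorem squareOf_eq (h : LiesIn z a b s A B) (hab : ¬((∃ m : ℤ, a = m) ∧ ∃ m : ℤ, b = m)) :
    (a - A = 1 → P.squareOf z = some (P.right s)) ∧
      (a - A ≠ 1 → b - B = 1 → P.squareOf z = some (P.up s)) ∧
      (a - A ≠ 1 → b - B ≠ 1 → P.squareOf z = some s) := by
  obtain ⟨x, rfl, h0, h1⟩ := h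
  have hnot : ¬((x.1 0 = 0 ∨ x.1 0 = 1) ∧ (x.1 1 = 0 ∨ x.1 1 = 1)) := by
    rw [h0, h1]
    rintro ⟨h2, h3⟩
    refine hab ⟨?_, ?_⟩
    · rcases h2 with h2 | h2
      · exact ⟨A, by linarith⟩
      · exact ⟨A + 1, by push_cast; linarith⟩
    · rcases h3 with h2 | h2
      · exact ⟨B, by linarith⟩
      · exact ⟨B + 1, by push_cast; linarith⟩
  rw [← h0, ← h1]
  refine ⟨fun h => ?_, fun h h' => ?_, fun h h' => ?_⟩
  · exact (if_neg hnot).trans (if_pos h)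
  · exact (if_neg hnot).trans ((if_neg h).trans (if_pos h'))
  · exact (if_neg hnot).trans ((if_neg h).trans (if_neg h'))

theorem square_eq (h : LiesIn z a b s A B) (h' : LiesIn z a b s' A B)
    (hab : ¬((∃ m : ℤ, a = m) ∧ ∃ m : ℤ, b = m)) : s' = s := by
  obtain ⟨h1, h2, h3⟩ := h.squareOf_eq hab
  obtain ⟨h1', h2', h3'⟩ := h'.squareOf_eq hab
  by_cases ha : a - A = 1
  · exact P.right.injective (Option.some_injective _ ((h1' ha).symm.trans (h1 ha)))
  by_cases hb : b - B = 1
  · exact P.up.injective (Option.some_injective _ ((h2' ha hb).symm.trans (h2 ha hb)))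
  · exact Option.some_injective _ ((h3' ha hb).symm.trans (h3 ha hb))

theorem square_eq_right (h : LiesIn z a b s A B) (h' : LiesIn z a b s' (A + 1) B)
    (hab : ¬((∃ m : ℤ, a = m) ∧ ∃ m : ℤ, b = m)) : s' = P.right s := by
  have ha := h.left_mem.2
  have ha' := h'.left_mem.1
  push_cast at ha'
  have e : a - A = 1 := by linarith
  have hb : b - B ≠ 1 := fun hb =>
    hab ⟨⟨A + 1, by push_cast; linarith⟩, ⟨B + 1, by push_cast; linarith⟩⟩
  exact Option.some_injective _ (((h'.squareOf_eq hab).2.2 (by push_cast; linarith) hb).symm.trans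
    ((h.squareOf_eq hab).1 e))

theorem square_eq_up (h : LiesIn z a b s A B) (h' : LiesIn z a b s' A (B + 1))
    (hab : ¬((∃ m : ℤ, a = m) ∧ ∃ m : ℤ, b = m)) : s' = P.up s := by
  have hb := h.right_mem.2
  have hb' := h'.right_mem.1
  push_cast at hb'
  have e : b - B = 1 := by linarith
  have ha : a - A ≠ 1 := fun ha =>
    hab ⟨⟨A + 1, by push_cast; linarith⟩, ⟨B + 1, by push_cast; linarith⟩⟩
  exact Option.some_injective _ (((h'.squareOf_eq hab).2.2 ha (by push_cast; linarith)).symm.trans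
    ((h.squareOf_eq hab).2.1 ha e))

/-- Moving the square vertically to row 0 removes the ambiguity of points on a horizontal edge,
giving a quantity that can stay constant along a strip. -/
theorem up_zpow_eq (h : LiesIn z a b s A B) (h' : LiesIn z a b s' A B')
    (hab : ¬((∃ m : ℤ, a = m) ∧ ∃ m : ℤ, b = m)) :
    (P.up ^ (-B')) s' = (P.up ^ (-B)) s := by
  have h1 := h.right_mem
  have h2 := h'.right_mem
  have h3 : B' ≤ B + 1 := by
    have : (B' : ℝ) ≤ B + 1 := by linarith [h1.2, h2.1]
    exact_mod_cast this
  have h4 : B ≤ B' + 1 := by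
    have : (B : ℝ) ≤ B' + 1 := by linarith [h1.1, h2.2]
    exact_mod_cast this
  obtain rfl | rfl | rfl : B' = B ∨ B' = B + 1 ∨ B = B' + 1 := by omega
  · rw [h.square_eq h' hab]
  · rw [h.square_eq_up h' hab, ← Equiv.Perm.mul_apply, ← zpow_add_one]
    congr 2
    ring
  · rw [h'.square_eq_up h hab, ← Equiv.Perm.mul_apply, ← zpow_add_one]
    congr 2
    ring

end LiesIn

variable {L : ℝ → P.Point} {u : EuclideanSpace ℝ (Fin 2)}

/-- The straight line starting at `(x₀, y₀)` lies over the geodesic. -/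
def IsLift (P : PolysquareSurface) (L : ℝ → P.Point) (u : EuclideanSpace ℝ (Fin 2))
    (x₀ y₀ : ℝ) : Prop :=
  ∀ t : ℝ, 0 ≤ t → P.character 0 (-1) (L t) = ((x₀ + t * u 0 : ℝ) : AddCircle (1 : ℝ)) ∧
    P.character 1 0 (L t) = ((y₀ + t * u 1 : ℝ) : AddCircle (1 : ℝ))

theorem IsGeodesic.exists_isLift (hL : P.IsGeodesic L u) : ∃ x₀ y₀, P.IsLift L u x₀ y₀ := by
  obtain ⟨x₀, hx⟩ := QuotientAddGroup.mk_surjective (P.character 0 (-1) (L 0))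
  obtain ⟨y₀, hy⟩ := QuotientAddGroup.mk_surjective (P.character 1 0 (L 0))
  refine ⟨x₀, y₀, fun t ht => ?_⟩
  rw [hL.character_eq _ _ ht, hL.character_eq _ _ ht, ← hx, ← hy, AddCircle.coe_add,
    AddCircle.coe_add]
  simp

section Lift

variable {x₀ y₀ : ℝ}

theorem IsLift.exists_liesIn (hl : P.IsLift L u x₀ y₀) {t : ℝ} (ht : 0 ≤ t) {F : Filter ℝ}
    (hF : pure t ≤ F) {s : P.Square} {x : unitSquare}
    (h : ∀ᶠ z in F, ∃ y : unitSquare, L z = P.pt s y ∧ ∀ i, y.1 i = x.1 i + (z - t) * u i) :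
    ∃ A B : ℤ, ∀ᶠ z in F, LiesIn (L z) (x₀ + z * u 0) (y₀ + z * u 1) s A B := by
  obtain ⟨y, hy, hi⟩ := hF h
  obtain ⟨h0, h1⟩ := hl t ht
  rw [hy, character_pt, AddCircle.coe_eq_coe_iff_exists_int] at h0 h1
  obtain ⟨A, hA⟩ := h0
  obtain ⟨B, hB⟩ := h1
  rw [hi, hi] at hA hB
  push_cast at hA hB
  refine ⟨-A, -B, h.mono ?_⟩
  rintro z ⟨w, hw, hwi⟩
  refine ⟨w, hw, ?_, ?_⟩
  · rw [hwi]; push_cast; linarith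
  · rw [hwi]; push_cast; linarith

theorem IsGeodesic.eventually_liesIn_nhdsGE (hL : P.IsGeodesic L u) (hl : P.IsLift L u x₀ y₀)
    {t : ℝ} (ht : 0 ≤ t) : ∃ (s : P.Square) (A B : ℤ), ∀ᶠ z in 𝓝[≥] t,
      LiesIn (L z) (x₀ + z * u 0) (y₀ + z * u 1) s A B := by
  obtain ⟨s, x, h⟩ := hL.eventually_nhdsGE ht
  exact ⟨s, hl.exists_liesIn ht (pure_le_nhdsWithin Set.self_mem_Ici) h⟩

theorem IsGeodesic.eventually_liesIn_nhdsLE (hL : P.IsGeodesic L u) (hl : P.IsLift L u x₀ y₀)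
    {t : ℝ} (ht : 0 < t) : ∃ (s : P.Square) (A B : ℤ), ∀ᶠ z in 𝓝[≤] t,
      LiesIn (L z) (x₀ + z * u 0) (y₀ + z * u 1) s A B := by
  obtain ⟨s, x, h⟩ := hL.eventually_nhdsLE ht
  exact ⟨s, hl.exists_liesIn ht.le (pure_le_nhdsWithin Set.self_mem_Iic) h⟩

variable {T T' : ℝ} {A : ℤ}

theorem LiesIn.column_eq {z : P.Point} {a b : ℝ} {s : P.Square} {A A' B : ℤ}
    (h : LiesIn z a b s A B) (ha : a - A' ∈ Set.Ioo (0 : ℝ) 1) : A = A' := by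
  have h1 := h.left_mem
  have h2 : (A : ℝ) < A' + 1 := by linarith [h1.1, ha.2]
  have h3 : (A' : ℝ) < A + 1 := by linarith [h1.2, ha.1]
  have h2' : A < A' + 1 := by exact_mod_cast h2
  have h3' : A' < A + 1 := by exact_mod_cast h3
  omega

/-- At the initial time the point may lie on a vertical edge between two columns; nearby later times
are interior to the strip and decide the column. -/
theorem IsGeodesic.eventually_liesIn_strip_nhdsGE (hL : P.IsGeodesic L u)
    (hl : P.IsLift L u x₀ y₀) (hT : 0 ≤ T)
    (hA : ∀ t ∈ Set.Ioo T T', x₀ + t * u 0 - A ∈ Set.Ioo (0 : ℝ) 1) {t : ℝ}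
    (ht : t ∈ Set.Ico T T') : ∃ (s : P.Square) (B : ℤ), ∀ᶠ z in 𝓝[≥] t,
      LiesIn (L z) (x₀ + z * u 0) (y₀ + z * u 1) s A B := by
  obtain ⟨s, A', B, h⟩ := hL.eventually_liesIn_nhdsGE hl (hT.trans ht.1)
  obtain ⟨z, hz, hz'⟩ := ((h.filter_mono (nhdsWithin_mono _ Set.Ioi_subset_Ici_self)).and
    (Ioo_mem_nhdsGT ht.2)).exists
  obtain rfl := hz.column_eq (hA z ⟨ht.1.trans_lt hz'.1, hz'.2⟩)
  exact ⟨s, B, h⟩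

theorem IsGeodesic.eventually_liesIn_strip_nhdsLE (hL : P.IsGeodesic L u)
    (hl : P.IsLift L u x₀ y₀) (hT : 0 ≤ T)
    (hA : ∀ t ∈ Set.Ioo T T', x₀ + t * u 0 - A ∈ Set.Ioo (0 : ℝ) 1) {t : ℝ}
    (ht : t ∈ Set.Ioc T T') : ∃ (s : P.Square) (B : ℤ), ∀ᶠ z in 𝓝[≤] t,
      LiesIn (L z) (x₀ + z * u 0) (y₀ + z * u 1) s A B := by
  obtain ⟨s, A', B, h⟩ := hL.eventually_liesIn_nhdsLE hl (hT.trans_lt ht.1)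
  obtain ⟨z, hz, hz'⟩ := ((h.filter_mono (nhdsWithin_mono _ Set.Iio_subset_Iic_self)).and
    (Ioo_mem_nhdsLT ht.1)).exists
  obtain rfl := hz.column_eq (hA z ⟨hz'.1, hz'.2.trans_le ht.2⟩)
  exact ⟨s, B, h⟩

theorem IsGeodesic.exists_liesIn_strip (hL : P.IsGeodesic L u)
    (hl : P.IsLift L u x₀ y₀) (hT : 0 ≤ T) (hTT' : T < T')
    (hA : ∀ t ∈ Set.Ioo T T', x₀ + t * u 0 - A ∈ Set.Ioo (0 : ℝ) 1) {t : ℝ}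
    (ht : t ∈ Set.Icc T T') : ∃ (s : P.Square) (B : ℤ),
      LiesIn (L t) (x₀ + t * u 0) (y₀ + t * u 1) s A B := by
  rcases ht.2.lt_or_eq with h | h
  · obtain ⟨s, B, h⟩ := hL.eventually_liesIn_strip_nhdsGE hl hT hA ⟨ht.1, h⟩
    exact ⟨s, B, h.self_of_nhdsWithin Set.self_mem_Ici⟩
  · obtain ⟨s, B, h⟩ := hL.eventually_liesIn_strip_nhdsLE hl hT hA ⟨h ▸ hTT', ht.2⟩
    exact ⟨s, B, h.self_of_nhdsWithin Set.self_mem_Iic⟩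

/-- While the geodesic crosses a vertical strip, its square changes only by steps up or down. -/
theorem IsGeodesic.up_zpow_eq_of_strip (hL : P.IsGeodesic L u)
    (hl : P.IsLift L u x₀ y₀) (hT : 0 ≤ T)
    (hA : ∀ t ∈ Set.Ioo T T', x₀ + t * u 0 - A ∈ Set.Ioo (0 : ℝ) 1)
    (hv : ∀ t ∈ Set.Icc T T', ¬((∃ m : ℤ, x₀ + t * u 0 = m) ∧ ∃ m : ℤ, y₀ + t * u 1 = m))
    {t : ℝ} (ht : t ∈ Set.Icc T T') {s s' : P.Square} {B B' : ℤ}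
    (h : LiesIn (L T) (x₀ + T * u 0) (y₀ + T * u 1) s A B)
    (h' : LiesIn (L t) (x₀ + t * u 0) (y₀ + t * u 1) s' A B') :
    (P.up ^ (-B')) s' = (P.up ^ (-B)) s := by
  classical
  -- The value does not depend on the chosen square and row, by `LiesIn.up_zpow_eq`; the default `s`
  -- only makes `g` total.
  let g : ℝ → P.Square := fun t =>
    if h : ∃ z : P.Square × ℤ, LiesIn (L t) (x₀ + t * u 0) (y₀ + t * u 1) z.1 A z.2 then
      (P.up ^ (-h.choose.2)) h.choose.1 else s
  have hg : ∀ t ∈ Set.Icc T T', ∀ s B, LiesIn (L t) (x₀ + t * u 0) (y₀ + t * u 1) s A B →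
      g t = (P.up ^ (-B)) s := by
    intro t ht s B h
    have hex : ∃ z : P.Square × ℤ, LiesIn (L t) (x₀ + t * u 0) (y₀ + t * u 1) z.1 A z.2 :=
      ⟨(s, B), h⟩
    exact (dif_pos hex).trans (h.up_zpow_eq hex.choose_spec (hv t ht))
  rw [← hg t ht s' B' h', ← hg T ⟨le_rfl, ht.1.trans ht.2⟩ s B h]
  refine eq_of_eventually_eq_nhdsGT_nhdsLT ht.1 (fun z hz => ?_) (fun z hz => ?_)
  · have hz' : z ∈ Set.Ico T T' := ⟨hz.1, hz.2.trans_le ht.2⟩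
    obtain ⟨s, B, h⟩ := hL.eventually_liesIn_strip_nhdsGE hl hT hA hz'
    have h0 := hg z ⟨hz'.1, hz'.2.le⟩ s B (h.self_of_nhdsWithin Set.self_mem_Ici)
    filter_upwards [h.filter_mono (nhdsWithin_mono _ Set.Ioi_subset_Ici_self),
      Ioo_mem_nhdsGT hz'.2] with w hw hw'
    rw [h0, hg w ⟨hz'.1.trans hw'.1.le, hw'.2.le⟩ s B hw]
  · have hz' : z ∈ Set.Ioc T T' := ⟨hz.1, hz.2.trans ht.2⟩
    obtain ⟨s, B, h⟩ := hL.eventually_liesIn_strip_nhdsLE hl hT hA hz'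
    have h0 := hg z ⟨hz'.1.le, hz'.2⟩ s B (h.self_of_nhdsWithin Set.self_mem_Iic)
    filter_upwards [h.filter_mono (nhdsWithin_mono _ Set.Iio_subset_Iic_self),
      Ioo_mem_nhdsLT hz'.1] with w hw hw'
    rw [h0, hg w ⟨hw'.1.le, hw'.2.le.trans hz'.2⟩ s B hw]

end Lift

/-- A line of irrational slope runs into lattice points only for a bounded time. -/
theorem exists_forall_gt_not_lattice {a b : ℝ} (ha : a ≠ 0) (h : Irrational (b / a)) (x₀ y₀ : ℝ) :
    ∃ τ : ℝ, 0 ≤ τ ∧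
      ∀ t, τ < t → ¬((∃ m : ℤ, x₀ + t * a = m) ∧ ∃ m : ℤ, y₀ + t * b = m) := by
  by_cases hex : ∃ τ : ℝ, 0 ≤ τ ∧ (∃ m : ℤ, x₀ + τ * a = m) ∧ ∃ m : ℤ, y₀ + τ * b = m
  · obtain ⟨τ, hτ, ⟨m, hm⟩, ⟨n, hn⟩⟩ := hex
    refine ⟨τ, hτ, ?_⟩
    rintro t ht ⟨⟨m', hm'⟩, ⟨n', hn'⟩⟩
    have h1 : t - τ ≠ 0 := by linarith
    refine h ⟨(n' - n : ℤ) / (m' - m : ℤ), ?_⟩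
    have e1 : (t - τ) * a = m' - m := by linarith
    have e2 : (t - τ) * b = n' - n := by linarith
    push_cast
    rw [← e1, ← e2]
    field_simp
  · push Not at hex
    refine ⟨0, le_rfl, ?_⟩
    rintro t ht ⟨h1, n, hn⟩
    exact hex t ht.le h1 n hn

/-- The squares which a geodesic of irrational slope enters through vertical edges form an orbit of
a skew product over a rotation, and between these edges the geodesic moves up and down. -/
theorem IsGeodesic.exists_isSkewOrbit (hL : P.IsGeodesic L u) (hu : u 0 ≠ 0)
    (hirr : Irrational (u 1 / u 0)) :
    ∃ (e : ℤ) (T y : ℝ) (s : ℕ → P.Square), (e = 1 ∨ e = -1) ∧ u 0 = e * |u 0| ∧ 0 ≤ T ∧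
      IsSkewOrbit (P.right ^ e) P.up (u 1 / |u 0|) y s ∧
      ∀ k : ℕ, ∀ θ ∈ Set.Icc (0 : ℝ) 1, ∃ (x : unitSquare) (B : ℤ),
        L (T + (k + θ) / |u 0|) = P.pt ((P.up ^ B) (s k)) x ∧
        (x.1 0 = if e = 1 then θ else 1 - θ) ∧
        x.1 1 = Int.fract (y + k * (u 1 / |u 0|)) + θ * (u 1 / |u 0|) - B := by
  obtain ⟨x₀, y₀, hl⟩ := hL.exists_isLift
  obtain ⟨τ, hτ, hv⟩ := exists_forall_gt_not_lattice hu hirr x₀ y₀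
  have hu' : 0 < |u 0| := abs_pos.2 hu
  obtain ⟨e, he, hue⟩ : ∃ e : ℤ, (e = 1 ∨ e = -1) ∧ u 0 = e * |u 0| := by
    rcases abs_choice (u 0) with h | h
    · exact ⟨1, Or.inl rfl, by rw [h]; simp⟩
    · exact ⟨-1, Or.inr rfl, by rw [h]; simp⟩
  have hee : (e : ℝ) * e = 1 := by rcases he with rfl | rfl <;> norm_num
  set v := |u 0| with hvdef
  set β := u 1 / v with hβ
  -- `T` is the first time after `τ` at which the line crosses a vertical grid line; from then on it
  -- meets no lattice point.
  set M : ℤ := ⌊v * τ + e * x₀⌋ + 1 with hM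
  set T : ℝ := (M - e * x₀) / v with hTdef
  have hTτ : τ < T := by
    rw [hTdef, lt_div_iff₀ hu', hM]
    push_cast
    linarith [Int.lt_floor_add_one (v * τ + e * x₀)]
  set t : ℕ → ℝ → ℝ := fun k θ => T + (k + θ) / v with ht
  have htX : ∀ k θ, x₀ + t k θ * u 0 = e * (M + k + θ) := by
    intro k θ
    simp only [ht, hTdef]
    rw [hue]
    field_simp
    linear_combination (-x₀) * hee
  have htY : ∀ k θ, y₀ + t k θ * u 1 = y₀ + T * u 1 + k * β + θ * β := by
    intro k θ
    simp only [ht, hβ]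
    field_simp
    ring
  have htτ : ∀ k θ, 0 ≤ θ → τ < t k θ := by
    intro k θ hθ
    have : 0 ≤ (k + θ) / v := by positivity
    simp only [ht]
    linarith
  -- The left side of the strip: a leftward geodesic enters it from the right side, one unit further
  -- on.
  set N : ℕ → ℤ := fun k => e * (M + k) + if e = 1 then 0 else -1 with hN
  have hcol : ∀ k θ, x₀ + t k θ * u 0 - N k = if e = 1 then θ else 1 - θ := by
    intro k θ
    rw [htX]
    rcases he with rfl | rfl
    · simp [hN]
    · simp [hN]; ring
  have hsucc : ∀ k, t (k + 1) 0 = t k 1 := by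
    intro k
    simp only [ht]
    push_cast
    ring
  have hparam : ∀ k, ∀ r ∈ Set.Ioo (t k 0) (t k 1), ∃ θ ∈ Set.Ioo (0 : ℝ) 1, r = t k θ := by
    intro k r hr
    refine ⟨(r - T) * v - k, ?_, ?_⟩
    · have h1 := hr.1
      have h2 := hr.2
      simp only [ht, ← sub_lt_iff_lt_add', ← lt_sub_iff_add_lt'] at h1 h2
      rw [div_lt_iff₀ hu'] at h1
      rw [lt_div_iff₀ hu'] at h2
      constructor <;> linarith
    · simp only [ht]
      field_simp
      ring
  have hstrip : ∀ k, ∀ r ∈ Set.Ioo (t k 0) (t k 1), x₀ + r * u 0 - N k ∈ Set.Ioo (0 : ℝ) 1 := by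
    intro k r hr
    obtain ⟨θ, hθ, rfl⟩ := hparam k r hr
    rw [hcol]
    split_ifs
    · exact hθ
    · exact ⟨by linarith [hθ.2], by linarith [hθ.1]⟩
  have hT0 : ∀ k, 0 ≤ t k 0 := fun k => hτ.trans (htτ k 0 le_rfl).le
  have hmono : ∀ k θ θ', θ ≤ θ' → t k θ ≤ t k θ' := by
    intro k θ θ' h
    simp only [ht]
    gcongr
  have hlt : ∀ k, t k 0 < t k 1 := by
    intro k
    simp only [ht]
    gcongr
    norm_num
  have hex : ∀ k, ∀ θ ∈ Set.Icc (0 : ℝ) 1, ∃ (s : P.Square) (B : ℤ),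
      LiesIn (L (t k θ)) (x₀ + t k θ * u 0) (y₀ + t k θ * u 1) s (N k) B := fun k θ hθ =>
    hL.exists_liesIn_strip hl (hT0 k) (hlt k) (hstrip k) ⟨hmono k _ _ hθ.1, hmono k _ _ hθ.2⟩
  have hcolInt : ∀ k, ∃ m : ℤ, x₀ + t k 0 * u 0 = m := fun k =>
    ⟨e * (M + k), by rw [htX]; push_cast; ring⟩
  -- On a vertical grid line the height is not an integer, as lattice points are excluded, so the
  -- row is unambiguous.
  have hrow : ∀ k s A B, LiesIn (L (t k 0)) (x₀ + t k 0 * u 0) (y₀ + t k 0 * u 1) s A B →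
      B = ⌊y₀ + t k 0 * u 1⌋ := by
    intro k s A B h
    have h1 := h.right_mem
    refine (Int.floor_eq_iff.2 ⟨by linarith [h1.1], lt_of_le_of_ne (by linarith [h1.2]) ?_⟩).symm
    intro h2
    exact hv _ (htτ k 0 le_rfl) ⟨hcolInt k, B + 1, by push_cast; exact h2⟩
  choose s B hs using fun k => hex k 0 ⟨le_rfl, zero_le_one⟩
  have hB : ∀ k, B k = ⌊y₀ + T * u 1 + k * β⌋ := by
    intro k
    rw [hrow k _ _ _ (hs k), htY, zero_mul, add_zero]
  have hmove : ∀ k, ∀ θ ∈ Set.Icc (0 : ℝ) 1, ∀ s' B',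
      LiesIn (L (t k θ)) (x₀ + t k θ * u 0) (y₀ + t k θ * u 1) s' (N k) B' →
      s' = (P.up ^ (B' - B k)) (s k) := by
    intro k θ hθ s' B' h'
    have h1 := hL.up_zpow_eq_of_strip hl (hT0 k) (hstrip k)
      (fun r hr => hv r ((htτ k 0 le_rfl).trans_le hr.1))
      ⟨hmono k _ _ hθ.1, hmono k _ _ hθ.2⟩ (hs k) h'
    rw [sub_eq_add_neg, zpow_add, Equiv.Perm.mul_apply, ← h1, ← Equiv.Perm.mul_apply, ← zpow_add]
    simp
  refine ⟨e, T, y₀ + T * u 1, s, he, hue, hτ.trans hTτ.le, fun k => ?_, fun k θ hθ => ?_⟩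
  · obtain ⟨s', B', h'⟩ := hex k 1 ⟨zero_le_one, le_rfl⟩
    have h1 := hmove k 1 ⟨zero_le_one, le_rfl⟩ s' B' h'
    rw [← hsucc] at h'
    have h2 : B' = B (k + 1) := by rw [hrow _ _ _ _ h', hrow _ _ _ _ (hs (k + 1))]
    rw [h2] at h1 h'
    have hcorner := hv _ (htτ (k + 1) 0 le_rfl)
    have h3 : s (k + 1) = (P.right ^ e) s' := by
      have h4 := hs (k + 1)
      rcases he with rfl | rfl
      · rw [show N (k + 1) = N k + 1 by simp only [hN]; push_cast; ring] at h4
        rw [zpow_one]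
        exact h'.square_eq_right h4 hcorner
      · rw [show N k = N (k + 1) + 1 by simp only [hN]; push_cast; ring] at h'
        rw [h4.square_eq_right h' hcorner]
        simp
    rw [h3, h1, hB, hB, fibrePerm, Equiv.Perm.mul_apply]
    push_cast
    rw [add_mul, one_mul, ← add_assoc]
  · obtain ⟨s', B', h'⟩ := hex k θ hθ
    have h1 := hmove k θ hθ s' B' h'
    obtain ⟨x, hx, hx0, hx1⟩ := h'
    refine ⟨x, B' - B k, h1 ▸ hx, hx0.trans (hcol k θ), ?_⟩
    rw [hx1, htY, Int.fract, ← hB]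
    push_cast
    ring

theorem isTransitivePair (P : PolysquareSurface) {e : ℤ} (he : e = 1 ∨ e = -1) :
    IsTransitivePair (P.right ^ e) P.up := by
  intro U hU hr hw
  have hr' : P.right ∈ MulAction.stabilizer (Equiv.Perm P.Square) U := by
    rcases he with rfl | rfl
    · simpa using hr
    · simpa using hr
  rw [MulAction.mem_stabilizer_set] at hr' hw
  obtain ⟨a, ha⟩ := hU
  refine Set.eq_univ_of_forall fun b => ?_
  have key : ∀ a b, Relation.EqvGen (fun a b => b = P.right a ∨ b = P.up a) a b →
      (a ∈ U ↔ b ∈ U) := by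
    intro a b h
    induction h with
    | rel a b h =>
      rcases h with rfl | rfl
      · exact (hr' a).symm
      · exact (hw a).symm
    | refl => exact Iff.rfl
    | symm _ _ _ ih => exact ih.symm
    | trans _ _ _ _ _ ih ih' => exact ih.trans ih'
  exact (key a b (P.connected a b)).1 ha

/-! ### Sufficiency of bad approximability -/

/-- A target interval pulled back along the flow may straddle a horizontal edge; one of its halves
stays within one square. -/
theorem exists_subinterval_between_integers {lo δ : ℝ} (hδ : 0 < δ) (hδ1 : 2 * δ ≤ 1) :
    ∃ z, lo ≤ z ∧ z + δ ≤ lo + 2 * δ ∧ z + δ ≤ ⌊z⌋ + 1 := by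
  by_cases h : lo + δ ≤ ⌊lo⌋ + 1
  · exact ⟨lo, le_rfl, by linarith, h⟩
  · push Not at h
    refine ⟨lo + δ, by linarith, by linarith, ?_⟩
    have h1 : ⌊lo⌋ + 1 ≤ ⌊lo + δ⌋ := Int.le_floor.2 (by push_cast; exact h.le)
    have h2 : (⌊lo⌋ : ℝ) + 1 ≤ ⌊lo + δ⌋ := by exact_mod_cast h1
    linarith [Int.lt_floor_add_one lo]

theorem IsGeodesic.superdense_of_badlyApproximable (hL : P.IsGeodesic L u) (hu : u 0 ≠ 0)
    (hα : BadlyApproximable (u 1 / u 0)) : P.Superdense L := by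
  have := P.finite_square
  obtain ⟨e, T, y, s, he, hue, hT, hs, hpos⟩ := hL.exists_isSkewOrbit hu hα.irrational
  set v := |u 0| with hv
  have hv0 : 0 < v := abs_pos.2 hu
  set β := u 1 / v with hβ
  have hβα : BadlyApproximable β := by
    rcases he with rfl | rfl
    · rwa [hue, Int.cast_one, one_mul] at hα
    · have := hα.neg
      rwa [hue, Int.cast_neg, Int.cast_one, neg_one_mul, div_neg, neg_neg] at this
  obtain ⟨C, hC, h⟩ := exists_skewOrbit_mem_interval _ _ hβα (P.isTransitivePair he)
  refine ⟨T + (2 * C + 1) / v, by positivity, fun n hn p => ?_⟩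
  obtain ⟨⟨s', x'⟩, rfl⟩ := Quot.exists_rep p
  have hn1 : (1 : ℝ) ≤ n := by exact_mod_cast hn
  have hn0 : (0 : ℝ) < n := by linarith
  set θ := if e = 1 then x'.1 0 else 1 - x'.1 0 with hθdef
  have hθ : θ ∈ Set.Icc (0 : ℝ) 1 := by
    have := x'.2 0
    rw [hθdef]
    split_ifs
    · exact this
    · exact ⟨by linarith [this.2], by linarith [this.1]⟩
  set δ : ℝ := 1 / (2 * n) with hδ
  have hδ0 : 0 < δ := by positivity
  have h2δ : 2 * δ = 1 / n := by rw [hδ]; field_simp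
  have h2δ1 : 2 * δ ≤ 1 := by rw [h2δ, div_le_one hn0]; exact hn1
  have hb := x'.2 1
  set b := x'.1 1 with hbdef
  -- Shifts the window of length `2δ` so that it contains `b` and stays inside `[0, 1]`.
  set b' := min b (1 - 2 * δ) with hb'
  have hb1 : b' ≤ b := min_le_left _ _
  have hb2 : b' ≤ 1 - 2 * δ := min_le_right _ _
  have hb3 : 0 ≤ b' := le_min hb.1 (by linarith)
  have hb4 : b ≤ b' + 2 * δ := by
    rcases min_choice b (1 - 2 * δ) with h | h <;> rw [hb', h] <;> linarith [hb.2]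
  obtain ⟨z, hz1, hz2, hz3⟩ := exists_subinterval_between_integers (lo := b' - θ * β) hδ0 h2δ1
  obtain ⟨k, hk, hsk, hfr⟩ := h y s hs δ hδ0 (by linarith) (z - ⌊z⌋) ((P.up ^ ⌊z⌋) s')
    (by linarith [Int.floor_le z]) (by linarith)
  obtain ⟨x, B, hLx, hx0, hx1⟩ := hpos k θ hθ
  have hx := x.2 1
  rw [hx1] at hx
  -- The height `fract + ⌊z⌋ + θβ` lies strictly inside the window, so only one integer shift puts
  -- it in `[0, 1]`; this identifies the square as `s'`.
  have hBz : B = -⌊z⌋ := by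
    have h1 : (B : ℝ) + ⌊z⌋ < 1 := by linarith [hx.1, hfr.2]
    have h2 : (-1 : ℝ) < B + ⌊z⌋ := by linarith [hx.2, hfr.1]
    have h1' : B + ⌊z⌋ < 1 := by exact_mod_cast h1
    have h2' : -1 < B + ⌊z⌋ := by exact_mod_cast h2
    omega
  have hsq : (P.up ^ B) (s k) = s' := by
    rw [hsk, hBz, ← Equiv.Perm.mul_apply, ← zpow_add]
    simp
  rw [hsq] at hLx
  refine ⟨T + (k + θ) / v, ⟨by have := hθ.1; positivity, ?_⟩, ?_⟩
  · have h1 : (k : ℝ) ≤ 2 * C * n := by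
      rw [hδ, mul_one_div, div_le_iff₀ (by positivity)] at hk
      linarith
    have h2 : (k : ℝ) + θ ≤ (2 * C + 1) * n := by linarith [hθ.2]
    have h3 : ((k : ℝ) + θ) / v ≤ (2 * C + 1) / v * n := by
      rw [div_mul_eq_mul_div]
      gcongr
    have h4 : T ≤ T * n := le_mul_of_one_le_right hT hn1
    linarith
  · rw [hLx]
    refine (joinedBy_pt s' x x').flatDist_le.trans ?_
    have hxx0 : x.1 0 = x'.1 0 := by
      rw [hx0, hθdef]
      split_ifs <;> simp
    rw [Subtype.dist_eq, EuclideanSpace.dist_eq, Fin.sum_univ_two, hxx0, dist_self, ← hbdef,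
      hx1, hBz]
    rw [zero_pow two_ne_zero, zero_add, Real.sqrt_sq dist_nonneg, Real.dist_eq, abs_le, ← h2δ]
    push_cast
    constructor <;> linarith [hfr.1, hfr.2]

end PolysquareSurface

theorem theorem1 (P : PolysquareSurface) (u : EuclideanSpace ℝ (Fin 2)) (L : ℝ → P.Point)
    (hL : P.IsGeodesic L u) :
    P.Superdense L ↔ (u 0 ≠ 0 ∧ BadlyApproximable (u 1 / u 0)) :=
  ⟨hL.badlyApproximable_of_superdense, fun h => hL.superdense_of_badlyApproximable h.1 h.2⟩
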